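/- **Setting.** Let $\Omega\subset\mathbb R^d$ be compact and convex and let $\mathcal P(\Omega)$ be the set of Borel probability measures on $\Omega$. For $\mu,\nu\in\mathcal P(\Omega)$ let $$\mathrm W(\mu,\nu)=\Big(\inf_{\pi}\int |x-y|^2\,\mathrm d\pi(x,y)\Big)^{1/2},$$ where $\pi$ ranges over all couplings of $\mu$ and $\nu$. For a curve $\rho:[0,1]\to\mathcal P(\Omega)$ that is Lipschitz with respect to $\mathrm W$, let $\mathrm{energy}(\rho)$ be the infimum of $\int_0^1\|v(t)\|^2_{L^2(\rho(t))}\,\mathrm dt$ over all measurable families $v(t)\in L^2(\rho(t);\mathbb R^d)$, $t\in[0,1]$, such that for all $\phi\in C^1([0,1]\times\Omega)$ $$\int_0^1\!\!\int\partial_t\phi(t,\cdot)\,\mathrm d\rho(t)\,\mathrm dt+\int_0^1\!\!\int\langle\nabla\phi(t,\cdot),v(t)\rangle\,\mathrm d\rho(t)\,\mathrm dt=\int\phi(1,\cdot)\,\mathrm d\rho(1)-\int\phi(0,\cdot)\,\mathrm d\rho(0).$$ **Assumptions.** (i) $\mathcal S$ is a compact connected $m$-dimensional smooth Riemannian manifold,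 or, more generally, a compact connected geodesically convex subset of an $m$-dimensional smooth Riemannian manifold without boundary; norm $\|\cdot\|_\theta$, exponential map and distance $d_{\mathcal S}$ are those of the manifold. $\mathcal D$ is a set of tangent vectors $(\theta,\eta)$, $\theta\in\mathcal S$, on which $\exp$ is defined, such that $(\theta,\eta)\in\mathcal D$ implies $(\theta,t\eta)\in\mathcal D$ for $t\in[0,1]$, and such that for $(\theta,\eta)\in\mathcal D$ the curve $\gamma(t)=\exp_\theta(t\eta)$, $t\in[0,1]$, is a geodesic in $\mathcal S$ from $\theta$ to $\exp_\theta(\eta)$ with $\|\dot\gamma(t)\|_{\gamma(t)}=\|\eta\|_\theta=d_{\mathcal S}(\theta,\exp_\theta(\eta))$. For all $\theta_0,\theta_1\in\mathcal S$ there is $\eta$ with $(\theta_0,\eta)\in\mathcal D$ and $\exp_{\theta_0}(\eta)=\theta_1$. (ii) $E:\mathcal S\to\mathcal P(\Omega)$ is bi-Lipschitz onto its image $\Lambda=E(\mathcal S)$ with respect to $d_{\mathcal S}$ and $\mathrm W$, and every $E(\theta)$ is absolutely continuous with respect to Lebesgue measure. (iii) For each $\theta\in\mathcal S$, $B_\theta$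 is a linear map from $T_\theta\mathcal S$ to the $C^1$ gradient vector fields on $\mathbb R^d$. There is a constant $c\in(0,\infty)$ such that for all $(\theta,\eta)\in\mathcal D$, $x\in\mathbb R^d$, $t\in[0,1]$, with $\gamma(t)=\exp_\theta(t\eta)$, $$\tfrac1c\|\eta\|_\theta\le\|B_\theta\eta\|_{L^2(E(\theta))}\le c\|\eta\|_\theta,\qquad \|B_\theta\eta\|_{C^1(\mathbb R^d)}\le c\|\eta\|_\theta,\qquad \big|\partial_t[B_{\gamma(t)}\dot\gamma(t)](x)\big|\le c\|\eta\|_\theta^2 .$$ (iv) For every Lipschitz curve $\gamma:[0,1]\to\mathcal S$ and the flow $\varphi:[0,1]\times\Omega\to\mathbb R^d$ with $\varphi(0,\cdot)=\mathrm{id}$ and $\partial_t\varphi(t,\cdot)=[B_{\gamma(t)}\dot\gamma(t)](\varphi(t,\cdot))$ for a.e. $t$, one has $E(\gamma(t))=\varphi(t,\cdot)_\#E(\gamma(0))$ for all $t\in[0,1]$. For $\mu,\nu\in\Lambda$ let $$\mathrm W_\Lambda(\mu,\nu)=\inf\big\{\mathrm{energy}(\rho)^{1/2}\ :\ \rho:[0,1]\to\Lambda\text{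 Lipschitz with respect to }\mathrm W,\ \rho(0)=\mu,\ \rho(1)=\nu\big\}.$$ **Proposition.** Under these assumptions there is a constant $C\in(0,\infty)$ such that for all $\lambda_0,\lambda_1\in\Lambda$ with $\lambda_0\ne\lambda_1$ one has $0<\mathrm W(\lambda_0,\lambda_1)<\infty$, $\mathrm W_\Lambda(\lambda_0,\lambda_1)<\infty$ and $$0\le\frac{\mathrm W_\Lambda(\lambda_0,\lambda_1)-\mathrm W(\lambda_0,\lambda_1)}{\mathrm W(\lambda_0,\lambda_1)^2}\le C .$$ -/

import Mathlib

open Set MeasureTheory Bundle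
open scoped ENNReal NNReal Manifold ContDiff

noncomputable section

namespace WassersteinSubmanifold

/-- Euclidean space of dimension `d`. -/
abbrev Euc (d : ℕ) : Type := EuclideanSpace ℝ (Fin d)

/-! ### Wasserstein distance, continuity equation, energy, geodesic restriction

Probability measures on `Ω ⊆ ℝ^d` are measures on `ℝ^d` that are concentrated on `Ω`. -/

section Transport

variable {d : ℕ}

/-- The Wasserstein-2 distance: the square root of the infimal quadratic cost among all transport
plans. -/
def W (μ ν : Measure (Euc d)) : ℝ≥0∞ :=
  (⨅ (p : Measure (Euc d × Euc d)) (_ : p.fst = μ ∧ p.snd = ν),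
    ∫⁻ z, ‖z.1 - z.2‖ₑ ^ 2 ∂p) ^ (1 / 2 : ℝ)

/-- `v` is a measurable family of velocity fields `v t ∈ L²(ρ t; ℝ^d)`, `t ∈ [0,1]`, that satisfies
the continuity equation with the curve `ρ` in the distributional sense. -/
structure IsContinuityEq (ρ : ℝ → Measure (Euc d)) (v : ℝ → Euc d → Euc d) : Prop where
  measurable : Measurable (Function.uncurry v)
  memLp : ∀ t ∈ Icc (0 : ℝ) 1, MemLp (v t) 2 (ρ t)
  continuity : ∀ φ : ℝ × Euc d → ℝ, ContDiff ℝ 1 φ →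
    (∫ t in (0 : ℝ)..1, ∫ x, fderiv ℝ φ (t, x) (1, 0) ∂(ρ t)) +
      (∫ t in (0 : ℝ)..1, ∫ x, fderiv ℝ φ (t, x) (0, v t x) ∂(ρ t)) =
    (∫ x, φ (1, x) ∂(ρ 1)) - ∫ x, φ (0, x) ∂(ρ 0)

/-- The energy of a curve of measures: the infimum of `∫₀¹ ‖v(t)‖²_{L²(ρ(t))} dt` among the
velocity fields that satisfy the continuity equation. -/
def energy (ρ : ℝ → Measure (Euc d)) : ℝ≥0∞ :=
  ⨅ (v : ℝ → Euc d → Euc d) (_ : IsContinuityEq ρ v),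
    ∫⁻ t in Icc (0 : ℝ) 1, ∫⁻ x, ‖v t x‖ₑ ^ 2 ∂(ρ t)

/-- `ρ ∈ Lip([0,1]; (Λ, W))` with `ρ 0 = μ` and `ρ 1 = ν`. -/
structure IsLipCurve (Λ : Set (Measure (Euc d))) (μ ν : Measure (Euc d))
    (ρ : ℝ → Measure (Euc d)) : Prop where
  mem : ∀ t ∈ Icc (0 : ℝ) 1, ρ t ∈ Λ
  lipschitz : ∃ K : ℝ≥0, ∀ s ∈ Icc (0 : ℝ) 1, ∀ t ∈ Icc (0 : ℝ) 1,
    W (ρ s) (ρ t) ≤ K * edist s t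
  source : ρ 0 = μ
  target : ρ 1 = ν

/-- The geodesic restriction of `W` to `Λ`. -/
def WRestr (Λ : Set (Measure (Euc d))) (μ ν : Measure (Euc d)) : ℝ≥0∞ :=
  ⨅ (ρ : ℝ → Measure (Euc d)) (_ : IsLipCurve Λ μ ν ρ), energy ρ ^ (1 / 2 : ℝ)

end Transport

/-! ### Geodesics and the exponential map of a Riemannian manifold -/

section Riemannian

variable {m : ℕ} {M : Type*} [TopologicalSpace M] [ChartedSpace (Euc m) M]

/-- The velocity `γ'(t)` of a curve `γ : [0,1] → M` (one-sided at the end points). -/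
def velocity (γ : ℝ → M) (t : ℝ) : TangentSpace (𝓡 m) (γ t) :=
  mfderivWithin 𝓘(ℝ, ℝ) (𝓡 m) γ (Icc 0 1) t (1 : ℝ)

variable [IsManifold (𝓡 m) ∞ M] [RiemannianBundle (fun x : M ↦ TangentSpace (𝓡 m) x)]

/-- The Riemannian metric in the chart centred at `p`, evaluated at the point of the manifold with
coordinates `y`, on two coordinate vectors `u` and `w`. -/
def chartMetric (p : M) (y u w : Euc m) : ℝ :=
  inner ℝ (mfderiv 𝓘(ℝ, Euc m) (𝓡 m) (extChartAt (𝓡 m) p).symm y u)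
    (mfderiv 𝓘(ℝ, Euc m) (𝓡 m) (extChartAt (𝓡 m) p).symm y w)

/-- The Christoffel symbols of the first kind in the chart centred at `p`, as a trilinear form:
`Γ(u, v; w) = (∂_u g(v, w) + ∂_v g(u, w) - ∂_w g(u, v)) / 2`. -/
def christoffel (p : M) (y u v w : Euc m) : ℝ :=
  (fderiv ℝ (fun z ↦ chartMetric p z v w) y u + fderiv ℝ (fun z ↦ chartMetric p z u w) y v
    - fderiv ℝ (fun z ↦ chartMetric p z u v) y w) / 2

/-- `γ : [0,1] → M` is the geodesic with `γ(0) = θ` and `γ'(0) = η`: a `C²` curve that satisfies,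
at each time `t` and in the chart centred at `γ t`, the geodesic equation `c'' + Γ(c', c') = 0`
(with the index lowered by the metric). -/
structure IsGeodesicFrom (θ : M) (η : TangentSpace (𝓡 m) θ) (γ : ℝ → M) : Prop where
  contMDiffOn : ContMDiffOn 𝓘(ℝ, ℝ) (𝓡 m) 2 γ (Icc 0 1)
  geodesicEq : ∀ t ∈ Icc (0 : ℝ) 1, ∀ w : Euc m,
    let c : ℝ → Euc m := fun s ↦ extChartAt (𝓡 m) (γ t) (γ s)
    let c' : Euc m := derivWithin c (Icc 0 1) t
    let c'' : Euc m := iteratedDerivWithin 2 c (Icc 0 1) t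
    chartMetric (γ t) (c t) c'' w + christoffel (γ t) (c t) c' c' w = 0
  initial : (⟨γ 0, velocity γ 0⟩ : TangentBundle (𝓡 m) M) = ⟨θ, η⟩

open Classical in
/-- The Riemannian exponential map `exp_θ(η) = γ(1)`, where `γ` is the geodesic with `γ(0) = θ` and
`γ'(0) = η` (and the junk value `θ` if there is no such geodesic up to time `1`). -/
def riemExp (θ : M) (η : TangentSpace (𝓡 m) θ) : M :=
  if h : ∃ γ : ℝ → M, IsGeodesicFrom θ η γ then h.choose 1 else θ

/-- The curve `t ↦ exp_θ(t η)`. -/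
def expCurve (θ : M) (η : TangentSpace (𝓡 m) θ) (t : ℝ) : M := riemExp θ (t • η)

end Riemannian

/-! ### Parametrized submanifolds of the Wasserstein space -/

section Submanifold

variable {d : ℕ}

/-- `φ : [0,1] × Ω → ℝ^d` is a flow of the time dependent vector field `v`: it is continuous in
space, absolutely continuous in time, `φ(0, ·) = id`, and `∂ₜφ(t, ·) = v(t, φ(t, ·))` on `Ω` for
a.e. `t`. -/
structure IsFlow (Ω : Set (Euc d)) (v : ℝ → Euc d → Euc d) (φ : ℝ → Euc d → Euc d) : Prop where
  continuousOn : ∀ t ∈ Icc (0 : ℝ) 1, ContinuousOn (φ t) Ω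
  absCont : ∀ x ∈ Ω, AbsolutelyContinuousOnInterval (fun t ↦ φ t x) 0 1
  initial : ∀ x ∈ Ω, φ 0 x = x
  ode : ∀ᵐ t ∂(volume.restrict (Icc (0 : ℝ) 1)), ∀ x ∈ Ω,
    HasDerivAt (fun s ↦ φ s x) (v t (φ t x)) t

variable {m : ℕ} {M : Type*} [EMetricSpace M] [ChartedSpace (Euc m) M] [IsManifold (𝓡 m) ∞ M]
  [RiemannianBundle (fun x : M ↦ TangentSpace (𝓡 m) x)]

/-- The velocity field `v(t, ·) = B_{γ(t)} γ'(t)` induced by a curve `γ : [0,1] → M`. -/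
def velField (B : ∀ θ : M, TangentSpace (𝓡 m) θ →ₗ[ℝ] (Euc d → Euc d)) (γ : ℝ → M)
    (t : ℝ) : Euc d → Euc d :=
  B (γ t) (velocity γ t)

/-- The standing assumptions on a parametrized submanifold `Λ = E(S)` of the Wasserstein space over
`Ω`. The parameter manifold `S` is a compact, connected, geodesically convex subset of an
`m`-dimensional smooth Riemannian manifold `M` without boundary (`S = M` if `S` itself has no
boundary), so that its tangent spaces, norm, exponential map and distance are those of `M`. The
data `D`, `E`, `B` matter over `S` only. -/
structure MainAssumption (Ω : Set (Euc d)) (S : Set M) (D : ∀ θ : M, Set (TangentSpace (𝓡 m) θ))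
    (E : M → Measure (Euc d)) (B : ∀ θ : M, TangentSpace (𝓡 m) θ →ₗ[ℝ] (Euc d → Euc d)) :
    Prop where
  /- the domain -/
  isCompact_domain : IsCompact Ω
  convex_domain : Convex ℝ Ω
  /- (i) the parameter manifold and the domain `D` of the exponential map -/
  isCompact : IsCompact S
  isConnected : IsConnected S
  smul_mem : ∀ θ ∈ S, ∀ η ∈ D θ, ∀ t ∈ Icc (0 : ℝ) 1, t • η ∈ D θ
  geodesic : ∀ θ ∈ S, ∀ η ∈ D θ, IsGeodesicFrom θ η (expCurve θ η)
  geodesic_mem : ∀ θ ∈ S, ∀ η ∈ D θ, ∀ t ∈ Icc (0 : ℝ) 1, expCurve θ η t ∈ S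
  speed : ∀ θ ∈ S, ∀ η ∈ D θ, ∀ t ∈ Icc (0 : ℝ) 1, ‖velocity (m := m) (expCurve θ η) t‖ = ‖η‖
  minimizing : ∀ θ ∈ S, ∀ η ∈ D θ, edist θ (riemExp θ η) = ‖η‖ₑ
  exists_geodesic : ∀ θ₀ ∈ S, ∀ θ₁ ∈ S, ∃ η ∈ D θ₀, riemExp θ₀ η = θ₁
  /- (ii) the embedding -/
  isProbabilityMeasure : ∀ θ ∈ S, IsProbabilityMeasure (E θ)
  concentrated : ∀ θ ∈ S, E θ Ωᶜ = 0
  absolutelyContinuous : ∀ θ ∈ S, E θ ≪ volume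
  biLipschitz : ∃ L : ℝ≥0, ∀ θ₀ ∈ S, ∀ θ₁ ∈ S,
    W (E θ₀) (E θ₁) ≤ L * edist θ₀ θ₁ ∧ edist θ₀ θ₁ ≤ L * W (E θ₀) (E θ₁)
  /- (iii) the velocity fields -/
  contDiff : ∀ θ ∈ S, ∀ η : TangentSpace (𝓡 m) θ, ContDiff ℝ 1 (B θ η)
  gradient : ∀ θ ∈ S, ∀ η : TangentSpace (𝓡 m) θ,
    ∃ f : Euc d → ℝ, ∀ x, HasGradientAt f (B θ η x) x
  bounds : ∃ C : ℝ, 0 < C ∧ ∀ θ ∈ S, ∀ η ∈ D θ,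
    ENNReal.ofReal (1 / C * ‖η‖) ≤ eLpNorm (B θ η) 2 (E θ) ∧
    eLpNorm (B θ η) 2 (E θ) ≤ ENNReal.ofReal (C * ‖η‖) ∧
    (∀ x, ‖B θ η x‖ ≤ C * ‖η‖) ∧
    (∀ x, ‖fderiv ℝ (B θ η) x‖ ≤ C * ‖η‖) ∧
    ∀ x, ∀ t ∈ Icc (0 : ℝ) 1,
      DifferentiableWithinAt ℝ (fun s ↦ velField B (expCurve θ η) s x) (Icc 0 1) t ∧
      ‖derivWithin (fun s ↦ velField B (expCurve θ η) s x) (Icc 0 1) t‖ ≤ C * ‖η‖ ^ 2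
  /- (iv) consistency of the velocity fields with the embedding -/
  consistent : ∀ γ : ℝ → M, (∀ t ∈ Icc (0 : ℝ) 1, γ t ∈ S) →
    (∃ K : ℝ≥0, LipschitzOnWith K γ (Icc 0 1)) →
    ∀ φ : ℝ → Euc d → Euc d, IsFlow Ω (velField B γ) φ →
    ∀ t ∈ Icc (0 : ℝ) 1, E (γ t) = (E (γ 0)).map (φ t)

end Submanifold

end WassersteinSubmanifold

end

/-!
Short curves in `Λ` are almost optimal. That `W ≤ W_Λ` is the easy half of the Benamou–Brenier
formula: by Kantorovich duality it is enough to test the continuity equation of a curve with a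
smooth subsolution of the Hamilton–Jacobi equation `∂ₜu + |∇u|² / 4 ≤ 0`, and one is obtained by
smoothing the Hopf–Lax formula over a finite net of `Ω` with a soft minimum. For the upper bound,
connect `E θ` to `E (exp_θ η)` by the image of the geodesic `γ` with initial velocity `η`. Its
velocity fields `B_γ γ'` differ by `O(|η|²)` from the field `g = B_θ η` along trajectories, so
that its energy is `∫ |g|² dE(θ) + O(|η|³)`, while its time-one flow is `id + g + O(|η|²)`. Since
`g` is a gradient with a small Lipschitz constant, its potential and the `c`-transform of it are
almost optimal in the dual problem, which gives `W² ≥ ∫ |g|² dE(θ) - O(|η|³)`. Hence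
`W_Λ² ≤ W² + O(|η|³)`, and `|η|` is comparable to `W`. The bounds on `B_γ γ'` are available only
for tangent vectors in `D`; to use them at a time `t`, one shows that `(1 - t) γ'(t)` is the initial velocity
of the curve in the family from `γ t` to `γ 1`, because the concatenation of two minimizing curves
that is itself minimizing has no corner.
-/

noncomputable section

open Filter Topology Manifold

namespace WassersteinSubmanifold

section CoordNorm

variable {F H : Type*} [NormedAddCommGroup F] [NormedSpace ℝ F] [TopologicalSpace H]
  {I : ModelWithCorners ℝ F H} {M : Type*} [TopologicalSpace M] [ChartedSpace H M]
  [RiemannianBundle (fun x : M ↦ TangentSpace I x)]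

variable (I) in
/-- The Riemannian norm at `p` of a vector given by its coordinates in the chart at `p`. Since
`TangentSpace I p` unfolds to the model space `F`, this keeps it apart from the norm of `F`. -/
def coordNorm (p : M) (w : F) : ℝ := norm (E := TangentSpace I p) w

theorem coordNorm_nonneg (p : M) (w : F) : 0 ≤ coordNorm I p w :=
  norm_nonneg (E := TangentSpace I p) w

theorem coordNorm_neg (p : M) (w : F) : coordNorm I p (-w) = coordNorm I p w :=
  norm_neg (E := TangentSpace I p) w

theorem coordNorm_smul (p : M) (c : ℝ) (w : F) :
    coordNorm I p (c • w) = |c| * coordNorm I p w :=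
  norm_smul (α := ℝ) (β := TangentSpace I p) c w

theorem eq_of_two_mul_le_coordNorm_add {p : M} {v w : F} {K : ℝ} (hv : coordNorm I p v ≤ K)
    (hw : coordNorm I p w ≤ K) (h : 2 * K ≤ coordNorm I p (v + w)) : v = w := by
  let v' : TangentSpace I p := v
  let w' : TangentSpace I p := w
  have hv' : ‖v'‖ ≤ K := hv
  have hw' : ‖w'‖ ≤ K := hw
  have hvw : 2 * K ≤ ‖v' + w'‖ := h
  have hsub : ‖v' - w'‖ = 0 := by
    nlinarith [parallelogram_law_with_norm ℝ v' w', norm_nonneg v', norm_nonneg w',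
      norm_nonneg (v' - w')]
  exact sub_eq_zero.1 ((norm_eq_zero (a := v' - w')).1 hsub)

theorem continuous_coordNorm (p : M) : Continuous (coordNorm I p) :=
  continuous_norm (E := TangentSpace I p)

variable [IsManifold I 1 M] [IsContinuousRiemannianBundle F (fun x : M ↦ TangentSpace I x)]

theorem eventually_norm_mfderivWithin_extChartAt_symm_le [I.Boundaryless] (p : M)
    {r : ℝ} (hr : 1 < r) :
    ∀ᶠ y in 𝓝 (extChartAt I p p), ∀ w : F,
      ‖mfderivWithin 𝓘(ℝ, F) I (extChartAt I p).symm (range I) y w‖ ≤ r * coordNorm I p w := by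
  have hnorm := (eventually_norm_symmL_trivializationAt_comp_self_lt F
    (fun x : M ↦ TangentSpace I x) p hr).and (chart_source_mem_nhds H p)
  have hsymm : Tendsto (extChartAt I p).symm (𝓝 (extChartAt I p p)) (𝓝 p) := by
    simpa only [extChartAt_to_inv] using (continuousAt_extChartAt_symm (I := I) p).tendsto
  filter_upwards [hsymm.eventually hnorm,
    extChartAt_target_mem_nhds (I := I) p] with y ⟨hy, hys⟩ hyt (w : TangentSpace I p)
  have hle := ContinuousLinearMap.le_of_opNorm_le _ hy.le w
  rwa [ContinuousLinearMap.comp_apply, TangentBundle.symmL_trivializationAt hys,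
    TangentBundle.continuousLinearMapAt_trivializationAt (mem_chart_source _ p),
    mfderiv_extChartAt_self, (extChartAt I p).right_inv hyt] at hle

end CoordNorm

section FirstOrderDistance

variable {F H : Type*} [NormedAddCommGroup F] [NormedSpace ℝ F] [TopologicalSpace H]
  {I : ModelWithCorners ℝ F H} {M : Type*} [PseudoEMetricSpace M] [ChartedSpace H M]
  [IsManifold I 1 M]

theorem mfderivWithin_extChartAt_symm_comp_lineMap {p : M} {a b : F}
    (hab : segment ℝ a b ⊆ (extChartAt I p).target) {t : ℝ} (ht : t ∈ Icc (0 : ℝ) 1) :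
    (mfderivWithin 𝓘(ℝ, ℝ) I ((extChartAt I p).symm ∘ AffineMap.lineMap a b) (Icc 0 1) t
        (1 : ℝ) : F) =
      (mfderivWithin 𝓘(ℝ, F) I (extChartAt I p).symm (range I) (AffineMap.lineMap a b t)
        (b - a) : F) := by
  have hmaps : MapsTo (AffineMap.lineMap (k := ℝ) a b) (Icc 0 1) (extChartAt I p).target :=
    fun s hs ↦ hab (segment_eq_image_lineMap ℝ a b ▸ mem_image_of_mem _ hs)
  have hline : HasDerivAt (AffineMap.lineMap (k := ℝ) a b) (b - a) t :=
    AffineMap.hasDerivAt_lineMap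
  have huniq := uniqueDiffOn_Icc (zero_lt_one (α := ℝ)) t ht
  rw [mfderivWithin_comp t (mdifferentiableWithinAt_extChartAt_symm (hmaps ht))
    hline.hasDerivWithinAt.differentiableWithinAt.mdifferentiableWithinAt
    (hmaps.mono_right (extChartAt_target_subset_range p))
    (uniqueMDiffWithinAt_iff_uniqueDiffWithinAt.2 huniq), mfderivWithin_eq_fderivWithin]
  exact congrArg _ (hline.hasDerivWithinAt.derivWithin huniq)

variable [RiemannianBundle (fun x : M ↦ TangentSpace I x)] [IsRiemannianManifold I M]

theorem edist_le_of_segment_extChartAt {p x y : M} (hx : x ∈ (extChartAt I p).source)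
    (hy : y ∈ (extChartAt I p).source) {K : ℝ}
    (h : ∀ z ∈ segment ℝ (extChartAt I p x) (extChartAt I p y), z ∈ (extChartAt I p).target ∧
      ‖mfderivWithin 𝓘(ℝ, F) I (extChartAt I p).symm (range I) z
        (extChartAt I p y - extChartAt I p x)‖ ≤ K) :
    edist x y ≤ ENNReal.ofReal K := by
  let l : ℝ → F := AffineMap.lineMap (k := ℝ) (extChartAt I p x) (extChartAt I p y)
  have hl : ∀ t ∈ Icc (0 : ℝ) 1, l t ∈ segment ℝ (extChartAt I p x) (extChartAt I p y) :=
    fun t ht ↦ segment_eq_image_lineMap ℝ _ (extChartAt I p y) ▸ mem_image_of_mem _ ht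
  have hsmooth : ContMDiffOn 𝓘(ℝ, ℝ) I 1 ((extChartAt I p).symm ∘ l) (Icc 0 1) :=
    (contMDiffOn_extChartAt_symm p).comp
      (AffineMap.contDiff_lineMap _ _).contMDiff.contMDiffOn fun t ht ↦ (h _ (hl t ht)).1
  have hbound : ∀ t ∈ Icc (0 : ℝ) 1,
      ‖mfderivWithin 𝓘(ℝ, ℝ) I ((extChartAt I p).symm ∘ l) (Icc 0 1) t 1‖ₑ ≤ ENNReal.ofReal K := by
    intro t ht
    rw [← ofReal_norm]
    refine ENNReal.ofReal_le_ofReal (Eq.trans_le ?_ (h _ (hl t ht)).2)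
    exact congrArg (norm (E := TangentSpace I ((extChartAt I p).symm (l t))))
      (mfderivWithin_extChartAt_symm_comp_lineMap (fun z hz ↦ (h z hz).1) ht)
  calc edist x y
      ≤ pathELength I ((extChartAt I p).symm ∘ l) 0 1 := by
        rw [IsRiemannianManifold.out (I := I) x y]
        refine riemannianEDist_le_pathELength hsmooth ?_ ?_ zero_le_one <;>
          simp [l, hx, hy, -extChartAt]
    _ ≤ ∫⁻ _ in Icc (0 : ℝ) 1, ENNReal.ofReal K := by
        rw [pathELength_eq_lintegral_mfderivWithin_Icc]
        exact setLIntegral_mono' measurableSet_Icc hbound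
    _ = ENNReal.ofReal K := by simp

variable [IsContinuousRiemannianBundle F (fun x : M ↦ TangentSpace I x)] [I.Boundaryless]

theorem eventually_edist_le_coordNorm_extChartAt_sub (p : M) {r : ℝ} (hr : 1 < r) :
    ∀ᶠ z in 𝓝 p ×ˢ 𝓝 p, edist z.1 z.2 ≤
      ENNReal.ofReal (r * coordNorm I p (extChartAt I p z.2 - extChartAt I p z.1)) := by
  obtain ⟨ε, hε, hball⟩ := Metric.mem_nhds_iff.1 (inter_mem
    (extChartAt_target_mem_nhds (I := I) p)
    (eventually_norm_mfderivWithin_extChartAt_symm_le (I := I) p hr))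
  have hnear : ∀ᶠ x in 𝓝 p, x ∈ (extChartAt I p).source ∧
      extChartAt I p x ∈ Metric.ball (extChartAt I p p) ε :=
    (eventually_mem_set.2 (extChartAt_source_mem_nhds p)).and
      ((continuousAt_extChartAt p).preimage_mem_nhds (Metric.ball_mem_nhds _ hε))
  filter_upwards [hnear.prod_mk hnear] with z ⟨⟨hx, hxb⟩, hy, hyb⟩
  refine edist_le_of_segment_extChartAt hx hy fun w hw ↦ ?_
  have hw' := hball ((convex_ball _ _).segment_subset hxb hyb hw)
  exact ⟨hw'.1, hw'.2 _⟩

theorem le_coordNorm_sub_of_le_edist {p : M} {c₁ c₂ : ℝ → M} {v₁ v₂ : F} {K : ℝ}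
    (h₁ : c₁ 0 = p) (h₂ : c₂ 0 = p) (hc₁ : ContinuousWithinAt c₁ (Ioi 0) 0)
    (hc₂ : ContinuousWithinAt c₂ (Ioi 0) 0)
    (hv₁ : HasDerivWithinAt (fun s ↦ extChartAt I p (c₁ s)) v₁ (Ioi 0) 0)
    (hv₂ : HasDerivWithinAt (fun s ↦ extChartAt I p (c₂ s)) v₂ (Ioi 0) 0)
    (hK : ∀ᶠ ε in 𝓝[>] (0 : ℝ), ENNReal.ofReal (K * ε) ≤ edist (c₁ ε) (c₂ ε)) :
    K ≤ coordNorm I p (v₂ - v₁) := by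
  have hquot : Tendsto (fun ε : ℝ ↦ coordNorm I p
      (ε⁻¹ • (extChartAt I p (c₂ ε) - extChartAt I p (c₁ ε)))) (𝓝[>] 0)
      (𝓝 (coordNorm I p (v₂ - v₁))) := by
    refine ((continuous_coordNorm p).tendsto _).comp
      (((hasDerivWithinAt_iff_tendsto_slope' self_notMem_Ioi).1 (hv₂.sub hv₁)).congr fun ε ↦ ?_)
    simp [slope, h₁, h₂, -extChartAt]
  have hpair : Tendsto (fun ε ↦ (c₁ ε, c₂ ε)) (𝓝[>] 0) (𝓝 p ×ˢ 𝓝 p) := by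
    simpa only [h₁, h₂] using Tendsto.prodMk hc₁.tendsto hc₂.tendsto
  have hratio : ∀ r > 1, K ≤ r * coordNorm I p (v₂ - v₁) := by
    intro r hr
    refine ge_of_tendsto (hquot.const_mul r) ?_
    filter_upwards [hK,
      hpair.eventually (eventually_edist_le_coordNorm_extChartAt_sub (I := I) p hr),
      self_mem_nhdsWithin] with ε hle hge (hε : 0 < ε)
    have h := (ENNReal.ofReal_le_ofReal_iff
      (mul_nonneg (zero_le_one.trans hr.le) (coordNorm_nonneg _ _))).1 (hle.trans hge)
    rwa [coordNorm_smul, abs_of_pos (inv_pos.2 hε), mul_left_comm, inv_mul_eq_div,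
      le_div_iff₀ hε]
  have hlim : Tendsto (fun r : ℝ ↦ r * coordNorm I p (v₂ - v₁)) (𝓝[>] 1)
      (𝓝 (1 * coordNorm I p (v₂ - v₁))) :=
    (tendsto_id.mono_left nhdsWithin_le_nhds).mul_const _
  rw [one_mul] at hlim
  exact ge_of_tendsto hlim (by filter_upwards [self_mem_nhdsWithin] with r hr using hratio r hr)

theorem eq_neg_of_two_mul_le_edist {p : M} {c₁ c₂ : ℝ → M} {v₁ v₂ : F} {K : ℝ}
    (h₁ : c₁ 0 = p) (h₂ : c₂ 0 = p) (hc₁ : ContinuousWithinAt c₁ (Ioi 0) 0)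
    (hc₂ : ContinuousWithinAt c₂ (Ioi 0) 0)
    (hv₁ : HasDerivWithinAt (fun s ↦ extChartAt I p (c₁ s)) v₁ (Ioi 0) 0)
    (hv₂ : HasDerivWithinAt (fun s ↦ extChartAt I p (c₂ s)) v₂ (Ioi 0) 0)
    (hK₁ : coordNorm I p v₁ ≤ K) (hK₂ : coordNorm I p v₂ ≤ K)
    (hK : ∀ᶠ ε in 𝓝[>] (0 : ℝ), ENNReal.ofReal (2 * K * ε) ≤ edist (c₁ ε) (c₂ ε)) :
    v₂ = -v₁ := by
  have h := le_coordNorm_sub_of_le_edist h₁ h₂ hc₁ hc₂ hv₁ hv₂ hK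
  rw [sub_eq_add_neg] at h
  exact eq_of_two_mul_le_coordNorm_add hK₂ ((coordNorm_neg p v₁).trans_le hK₁) h

end FirstOrderDistance

section MinimizingCurves

variable {m : ℕ} {M : Type*} [PseudoEMetricSpace M] [ChartedSpace (Euc m) M]

theorem hasDerivWithinAt_extChartAt_velocity {γ : ℝ → M}
    (hγ : ContMDiffOn 𝓘(ℝ, ℝ) (𝓡 m) 1 γ (Icc 0 1)) {t : ℝ} (ht : t ∈ Icc (0 : ℝ) 1) :
    HasDerivWithinAt (fun s ↦ extChartAt (𝓡 m) (γ t) (γ s)) (velocity (m := m) γ t : Euc m)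
      (Icc 0 1) t := by
  have hder := ((hγ t ht).mdifferentiableWithinAt one_ne_zero).hasMFDerivWithinAt.2
  simp only [writtenInExtChartAt, mfld_simps] at hder
  exact HasFDerivWithinAt.hasDerivWithinAt (F := Euc m) hder

variable [RiemannianBundle (fun x : M ↦ TangentSpace (𝓡 m) x)]

variable (m) in
/-- A `C¹` curve on `[0, 1]` of constant speed `K` whose length `K` is the distance of its end
points. -/
structure IsMinimizingCurve (K : ℝ) (γ : ℝ → M) : Prop where
  contMDiffOn : ContMDiffOn 𝓘(ℝ, ℝ) (𝓡 m) 1 γ (Icc 0 1)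
  norm_velocity : ∀ t ∈ Icc (0 : ℝ) 1, ‖velocity (m := m) γ t‖ = K
  edist_endpoints : edist (γ 0) (γ 1) = ENNReal.ofReal K

namespace IsMinimizingCurve

variable {K K' : ℝ} {γ σ : ℝ → M}

theorem speed_nonneg (h : IsMinimizingCurve m K γ) : 0 ≤ K :=
  h.norm_velocity 0 ⟨le_rfl, zero_le_one⟩ ▸ norm_nonneg _

theorem exists_coord_velocity (h : IsMinimizingCurve m K γ) {t : ℝ} (ht : t ∈ Icc (0 : ℝ) 1)
    {p : M} (hp : γ t = p) :
    ∃ V : Euc m, HasDerivWithinAt (fun s ↦ extChartAt (𝓡 m) p (γ s)) V (Icc 0 1) t ∧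
      coordNorm (𝓡 m) p V = K ∧
      ∀ r : ℝ, (⟨γ t, r • velocity γ t⟩ : TangentBundle (𝓡 m) M) = ⟨p, (r • V : Euc m)⟩ := by
  subst hp
  exact ⟨velocity (m := m) γ t, hasDerivWithinAt_extChartAt_velocity h.contMDiffOn ht,
    h.norm_velocity t ht, fun _ ↦ rfl⟩

variable [IsRiemannianManifold (𝓡 m) M]

theorem edist_le (h : IsMinimizingCurve m K γ) {s t : ℝ} (hs : 0 ≤ s) (hst : s ≤ t)
    (ht : t ≤ 1) : edist (γ s) (γ t) ≤ ENNReal.ofReal (K * (t - s)) := by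
  have hspeed : ∀ u ∈ Ioo s t, ‖mfderiv 𝓘(ℝ, ℝ) (𝓡 m) γ u 1‖ₑ = ENNReal.ofReal K := by
    intro u hu
    rw [← mfderivWithin_of_mem_nhds (Icc_mem_nhds (hs.trans_lt hu.1) (hu.2.trans_le ht)),
      ← ofReal_norm]
    exact congrArg _ (h.norm_velocity u ⟨hs.trans hu.1.le, hu.2.le.trans ht⟩)
  calc edist (γ s) (γ t) ≤ pathELength (𝓡 m) γ s t := by
        rw [IsRiemannianManifold.out (I := 𝓡 m) (γ s) (γ t)]
        exact riemannianEDist_le_pathELength (h.contMDiffOn.mono (Icc_subset_Icc hs ht)) rfl rfl hst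
    _ = ∫⁻ _ in Ioo s t, ENNReal.ofReal K := by
        rw [pathELength_eq_lintegral_mfderiv_Ioo, setLIntegral_congr_fun measurableSet_Ioo hspeed]
    _ = ENNReal.ofReal (K * (t - s)) := by simp [ENNReal.ofReal_mul h.speed_nonneg]

theorem edist_eq (h : IsMinimizingCurve m K γ) {s t : ℝ} (hs : 0 ≤ s) (hst : s ≤ t)
    (ht : t ≤ 1) : edist (γ s) (γ t) = ENNReal.ofReal (K * (t - s)) := by
  have hK := h.speed_nonneg
  refine le_antisymm (h.edist_le hs hst ht) ?_
  have htri : ENNReal.ofReal K ≤ ENNReal.ofReal (K * (s - 0)) + edist (γ s) (γ t) +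
      ENNReal.ofReal (K * (1 - t)) := by
    rw [← h.edist_endpoints]
    refine (edist_triangle4 _ (γ s) (γ t) _).trans ?_
    gcongr
    exacts [h.edist_le le_rfl hs (hst.trans ht), h.edist_le (hs.trans hst) ht le_rfl]
  rw [← tsub_le_iff_right, ← tsub_le_iff_left,
    ← ENNReal.ofReal_sub _ (mul_nonneg hK (sub_nonneg.2 ht)),
    ← ENNReal.ofReal_sub _ (by simpa using mul_nonneg hK hs)] at htri
  convert htri using 2
  ring

theorem edist_le_mul (h : IsMinimizingCurve m K γ) {s t : ℝ} (hs : s ∈ Icc (0 : ℝ) 1)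
    (ht : t ∈ Icc (0 : ℝ) 1) : edist (γ s) (γ t) ≤ ENNReal.ofReal K * edist s t := by
  wlog hst : s ≤ t generalizing s t
  · rw [edist_comm, edist_comm s]
    exact this ht hs (le_of_not_ge hst)
  refine (h.edist_le hs.1 hst ht.2).trans_eq ?_
  rw [ENNReal.ofReal_mul h.speed_nonneg, edist_comm s, edist_dist, Real.dist_eq,
    abs_of_nonneg (sub_nonneg.2 hst)]

theorem speed_eq_of_edist_endpoints (h : IsMinimizingCurve m K γ)
    (hσ : IsMinimizingCurve m K' σ) {t : ℝ} (ht : t ∈ Icc (0 : ℝ) 1) (h0 : σ 0 = γ t)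
    (h1 : σ 1 = γ 1) : K' = (1 - t) * K := by
  have hdist := h.edist_eq ht.1 ht.2 le_rfl
  rwa [← h0, ← h1, hσ.edist_endpoints,
    ENNReal.ofReal_eq_ofReal_iff hσ.speed_nonneg
      (mul_nonneg h.speed_nonneg (sub_nonneg.2 ht.2)), mul_comm] at hdist

/-- Going backwards along `γ` and forwards along `σ`, one separates at full speed, since the
concatenation of `γ` up to time `t` with `σ` is again minimizing. -/
theorem two_mul_le_edist (h : IsMinimizingCurve m K γ)
    (hσ : IsMinimizingCurve m K' σ) {t : ℝ} (ht : t ∈ Ioo (0 : ℝ) 1) (h0 : σ 0 = γ t)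
    (h1 : σ 1 = γ 1) {ε : ℝ} (hε : ε ∈ Ioo 0 (min t (1 - t))) :
    ENNReal.ofReal (2 * K * ε) ≤ edist (γ (t - ε)) (σ ((1 - t)⁻¹ * ε)) := by
  obtain ⟨hε0, hεt⟩ : 0 < ε ∧ ε < t ∧ ε < 1 - t := ⟨hε.1, lt_min_iff.1 hε.2⟩
  have hK := h.speed_nonneg
  have ht1 : 0 < 1 - t := sub_pos.2 ht.2
  have hs1 : (1 - t)⁻¹ * ε ≤ 1 := by rw [inv_mul_le_one₀ ht1]; exact hεt.2.le
  have htri := edist_triangle4 (γ 0) (γ (t - ε)) (σ ((1 - t)⁻¹ * ε)) (γ 1)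
  rw [h.edist_endpoints, h.edist_eq le_rfl (by linarith) (by linarith), ← h1,
    hσ.edist_eq (by positivity) hs1 le_rfl, h.speed_eq_of_edist_endpoints hσ
      (Ioo_subset_Icc_self ht) h0 h1, ← tsub_le_iff_right, ← tsub_le_iff_left,
    ← ENNReal.ofReal_sub _ (mul_nonneg (mul_nonneg ht1.le hK) (sub_nonneg.2 hs1)),
    ← ENNReal.ofReal_sub _ (mul_nonneg hK (by linarith))] at htri
  refine (congrArg ENNReal.ofReal ?_).trans_le htri
  linear_combination -K * ε * mul_inv_cancel₀ ht1.ne'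

variable [IsManifold (𝓡 m) 1 M]
  [IsContinuousRiemannianBundle (Euc m) (fun x : M ↦ TangentSpace (𝓡 m) x)]

/-- Minimizing curves have no corners. -/
theorem velocity_eq_of_endpoints (h : IsMinimizingCurve m K γ)
    (hσ : IsMinimizingCurve m K' σ) {t : ℝ} (ht : t ∈ Ioo (0 : ℝ) 1) (h0 : σ 0 = γ t)
    (h1 : σ 1 = γ 1) :
    (⟨σ 0, velocity σ 0⟩ : TangentBundle (𝓡 m) M) = ⟨γ t, (1 - t) • velocity γ t⟩ := by
  have ht1 : 0 < 1 - t := sub_pos.2 ht.2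
  have hIcc : Icc (0 : ℝ) 1 ∈ 𝓝 t := Icc_mem_nhds ht.1 ht.2
  have hIoi : Icc (0 : ℝ) 1 ∈ 𝓝[>] (0 : ℝ) :=
    mem_of_superset (Ioo_mem_nhdsGT zero_lt_one) Ioo_subset_Icc_self
  have ht' := Ioo_subset_Icc_self ht
  have h0' : (0 : ℝ) ∈ Icc (0 : ℝ) 1 := ⟨le_rfl, zero_le_one⟩
  have hback : HasDerivAt (fun ε : ℝ ↦ t - ε) (-1) 0 := by
    simpa using (hasDerivAt_id (0 : ℝ)).const_sub t
  have hforth : HasDerivWithinAt (fun ε : ℝ ↦ (1 - t)⁻¹ * ε) (1 - t)⁻¹ (Ioi 0) 0 := by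
    simpa using ((hasDerivAt_id (0 : ℝ)).const_mul (1 - t)⁻¹).hasDerivWithinAt
  have hmaps : MapsTo (fun ε : ℝ ↦ (1 - t)⁻¹ * ε) (Ioi 0) (Ioi 0) :=
    fun ε hε ↦ mul_pos (inv_pos.2 ht1) hε
  obtain ⟨V, hV, hVnorm, hVeq⟩ := h.exists_coord_velocity ht' rfl
  obtain ⟨X, hX, hXnorm, hXeq⟩ := hσ.exists_coord_velocity h0' h0
  have hγv := (hV.hasDerivAt hIcc).scomp_of_eq 0 hback (sub_zero t).symm
  have hσv := (hX.mono_of_mem_nhdsWithin hIoi).scomp_of_eq 0 hforth hmaps (mul_zero _).symm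
  have hγc := ((h.contMDiffOn.continuousOn t ht').continuousAt hIcc).comp_of_eq
    hback.continuousAt (sub_zero t)
  have hσc := ((hσ.contMDiffOn.continuousOn 0 h0').mono_of_mem_nhdsWithin hIoi).comp_of_eq
    hforth.continuousWithinAt hmaps (mul_zero _)
  have hopp : (1 - t)⁻¹ • X = -((-1 : ℝ) • V) := by
    refine eq_neg_of_two_mul_le_edist (I := 𝓡 m) (K := K) (c₁ := fun ε ↦ γ (t - ε))
      (c₂ := fun ε ↦ σ ((1 - t)⁻¹ * ε)) (by rw [sub_zero]) (by rw [mul_zero, h0])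
      hγc.continuousWithinAt hσc hγv.hasDerivWithinAt hσv ?_ ?_ ?_
    · rw [neg_one_smul, coordNorm_neg, hVnorm]
    · rw [coordNorm_smul, hXnorm, h.speed_eq_of_edist_endpoints hσ ht' h0 h1,
        abs_of_pos (inv_pos.2 ht1), inv_mul_cancel_left₀ ht1.ne']
    · filter_upwards [Ioo_mem_nhdsGT (lt_min ht.1 ht1)] with ε hε
      exact h.two_mul_le_edist hσ ht h0 h1 hε
  rw [neg_one_smul, neg_neg, inv_smul_eq_iff₀ ht1.ne'] at hopp
  rw [hVeq, ← hopp]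
  simpa only [one_smul] using hXeq 1

end IsMinimizingCurve

/-- A family of minimizing curves `c θ η` in `S`, for `θ ∈ S` and `η ∈ D θ`, that start at `θ` with
velocity `η` and such that any two points of `S` are joined by one of them: the properties of
`t ↦ exp_θ(t η)` that are relevant for the comparison of distances. -/
structure IsMinimizingFamily (S : Set M) (D : ∀ θ : M, Set (TangentSpace (𝓡 m) θ))
    (c : ∀ θ : M, TangentSpace (𝓡 m) θ → ℝ → M) : Prop where
  initial : ∀ θ ∈ S, ∀ η ∈ D θ,
    (⟨c θ η 0, velocity (c θ η) 0⟩ : TangentBundle (𝓡 m) M) = ⟨θ, η⟩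
  isMinimizingCurve : ∀ θ ∈ S, ∀ η ∈ D θ, IsMinimizingCurve m ‖η‖ (c θ η)
  mem : ∀ θ ∈ S, ∀ η ∈ D θ, ∀ t ∈ Icc (0 : ℝ) 1, c θ η t ∈ S
  exists_joining : ∀ θ₀ ∈ S, ∀ θ₁ ∈ S, ∃ η ∈ D θ₀, c θ₀ η 1 = θ₁

namespace IsMinimizingFamily

variable {S : Set M} {D : ∀ θ : M, Set (TangentSpace (𝓡 m) θ)}
  {c : ∀ θ : M, TangentSpace (𝓡 m) θ → ℝ → M} {θ : M} {η : TangentSpace (𝓡 m) θ}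

theorem apply_zero (h : IsMinimizingFamily S D c) (hθ : θ ∈ S) (hη : η ∈ D θ) : c θ η 0 = θ :=
  congrArg TotalSpace.proj (h.initial θ hθ η hη)

variable [IsRiemannianManifold (𝓡 m) M] [IsManifold (𝓡 m) 1 M]
  [IsContinuousRiemannianBundle (Euc m) (fun x : M ↦ TangentSpace (𝓡 m) x)]

theorem smul_velocity_mem (h : IsMinimizingFamily S D c) (hθ : θ ∈ S) (hη : η ∈ D θ) {t : ℝ}
    (ht : t ∈ Ico (0 : ℝ) 1) : (1 - t) • velocity (c θ η) t ∈ D (c θ η t) := by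
  have hmem : ∀ {z z' : TangentBundle (𝓡 m) M}, z = z' → z.2 ∈ D z.1 → z'.2 ∈ D z'.1 := by
    rintro z _ rfl hz
    exact hz
  rcases ht.1.eq_or_lt with rfl | ht0
  · rw [sub_zero, one_smul]
    exact hmem (h.initial θ hθ η hη).symm hη
  have hpS := h.mem θ hθ η hη t (Ico_subset_Icc_self ht)
  have h1S := h.mem θ hθ η hη 1 ⟨zero_le_one, le_rfl⟩
  obtain ⟨ξ, hξ, hξ1⟩ := h.exists_joining _ hpS _ h1S
  have hcorner := (h.isMinimizingCurve θ hθ η hη).velocity_eq_of_endpoints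
    (h.isMinimizingCurve _ hpS ξ hξ) ⟨ht0, ht.2⟩ (h.apply_zero hpS hξ) hξ1
  exact hmem ((h.initial _ hpS ξ hξ).symm.trans hcorner) hξ

end IsMinimizingFamily

end MinimizingCurves

section CompactlyConcentrated

theorem integrable_of_isCompact {X G : Type*} [TopologicalSpace X] [T2Space X]
    [MeasurableSpace X] [OpensMeasurableSpace X] [NormedAddCommGroup G] {μ : Measure X}
    [IsFiniteMeasureOnCompacts μ] {Ω : Set X} (hΩ : IsCompact Ω) (hμ : μ Ωᶜ = 0) {g : X → G}
    (hg : ContinuousOn g Ω) : Integrable g μ := by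
  rw [← Measure.restrict_eq_self_of_ae_mem (s := Ω) hμ]
  exact hg.integrableOn_compact hΩ

theorem intervalIntegral_integral_map_swap {X Y : Type*} [TopologicalSpace X] [T2Space X]
    [SecondCountableTopology X] [MeasurableSpace X] [BorelSpace X] [TopologicalSpace Y]
    [MeasurableSpace Y] [BorelSpace Y] {μ : Measure X} [IsFiniteMeasure μ] {Ω : Set X}
    (hΩ : IsCompact Ω) (hμ : μ Ωᶜ = 0) {Φ : ℝ → X → Y} (hΦ : Continuous (Function.uncurry Φ))
    {g : ℝ × Y → ℝ} (hg : Continuous g) :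
    ∫ t in (0 : ℝ)..1, ∫ y, g (t, y) ∂(μ.map (Φ t)) =
      ∫ x, (∫ t in (0 : ℝ)..1, g (t, Φ t x)) ∂μ := by
  have hgΦ : Continuous (Function.uncurry fun t x ↦ g (t, Φ t x)) :=
    hg.comp (continuous_fst.prodMk hΦ)
  have hint : Integrable (Function.uncurry fun t x ↦ g (t, Φ t x))
      ((volume.restrict (uIoc (0 : ℝ) 1)).prod μ) := by
    have hIcc : IntegrableOn (Function.uncurry fun t x ↦ g (t, Φ t x))
        (Icc (0 : ℝ) 1 ×ˢ Ω) (volume.prod μ) :=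
      hgΦ.continuousOn.integrableOn_compact (isCompact_Icc.prod hΩ)
    have hsub : uIoc (0 : ℝ) 1 ×ˢ Ω ⊆ Icc (0 : ℝ) 1 ×ˢ Ω :=
      prod_mono_left (uIoc_of_le (zero_le_one (α := ℝ)) ▸ Ioc_subset_Icc_self)
    rw [← Measure.restrict_eq_self_of_ae_mem (s := Ω) hμ, Measure.prod_restrict]
    exact hIcc.mono_set hsub
  rw [← intervalIntegral_integral_swap hint]
  refine intervalIntegral.integral_congr fun t _ ↦ ?_
  exact integral_map (hΦ.comp (Continuous.prodMk_right t)).aemeasurable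
    (hg.comp (Continuous.prodMk_right t)).aestronglyMeasurable

theorem integral_intervalIntegral_add {X : Type*} [TopologicalSpace X] [T2Space X]
    [FirstCountableTopology X] [MeasurableSpace X] [OpensMeasurableSpace X] {μ : Measure X}
    [IsFiniteMeasureOnCompacts μ] {Ω : Set X} (hΩ : IsCompact Ω) (hμ : μ Ωᶜ = 0)
    {g₁ g₂ : X → ℝ → ℝ} (hg₁ : Continuous (Function.uncurry g₁))
    (hg₂ : Continuous (Function.uncurry g₂)) :
    ∫ x, (∫ t in (0 : ℝ)..1, g₁ x t) ∂μ + ∫ x, (∫ t in (0 : ℝ)..1, g₂ x t) ∂μ =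
      ∫ x, (∫ t in (0 : ℝ)..1, (g₁ x t + g₂ x t)) ∂μ := by
  have hint : ∀ {g : X → ℝ → ℝ}, Continuous (Function.uncurry g) →
      Integrable (fun x ↦ ∫ t in (0 : ℝ)..1, g x t) μ := fun hg ↦
    integrable_of_isCompact hΩ hμ
      (intervalIntegral.continuous_parametric_intervalIntegral_of_continuous' hg 0 1).continuousOn
  rw [← integral_add (hint hg₁) (hint hg₂)]
  refine integral_congr_ae (ae_of_all _ fun x ↦ ?_)
  exact (intervalIntegral.integral_add
    ((hg₁.comp (Continuous.prodMk_right x)).intervalIntegrable _ _)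
    ((hg₂.comp (Continuous.prodMk_right x)).intervalIntegrable _ _)).symm

end CompactlyConcentrated

section Flow

variable {F : Type*} [NormedAddCommGroup F] {w Φ : ℝ → F → F} {A K : ℝ≥0}

/-- A time dependent vector field that is bounded by `A`, `A`-Lipschitz in space and `K`-Lipschitz
in time. A single constant `A` is enough for the fields along a geodesic, where both bounds are
multiples of its length. -/
structure IsLipschitzField (w : ℝ → F → F) (A K : ℝ≥0) : Prop where
  norm_le : ∀ t x, ‖w t x‖ ≤ A
  lipschitzWith_space : ∀ t, LipschitzWith A (w t)
  lipschitzWith_time : ∀ x, LipschitzWith K fun t ↦ w t x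

theorem IsLipschitzField.continuous (hw : IsLipschitzField w A K) :
    Continuous (Function.uncurry w) :=
  continuous_prod_of_continuous_lipschitzWith' _ A hw.lipschitzWith_space
    fun x ↦ (hw.lipschitzWith_time x).continuous

variable [NormedSpace ℝ F]

/-- `Φ` is a continuous flow of `w` on the whole space for times in `[0, 1]`. In contrast to
`IsFlow`, the differential equation holds at all times. -/
structure IsGlobalFlow (w Φ : ℝ → F → F) : Prop where
  continuous : Continuous (Function.uncurry Φ)
  initial : ∀ x, Φ 0 x = x
  hasDerivWithinAt : ∀ x, ∀ t ∈ Icc (0 : ℝ) 1,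
    HasDerivWithinAt (fun s ↦ Φ s x) (w t (Φ t x)) (Icc 0 1) t

theorem IsLipschitzField.exists_trajectory [CompleteSpace F] (hw : IsLipschitzField w A K) (x : F) :
    ∃ α : ℝ → F, α 0 = x ∧
      ∀ t ∈ Icc (0 : ℝ) 1, HasDerivWithinAt α (w t (α t)) (Icc 0 1) t := by
  have hpl : IsPicardLindelof w (⟨0, le_rfl, zero_le_one⟩ : Icc (0 : ℝ) 1) x A 0 A A :=
    { lipschitzOnWith := fun t _ ↦ (hw.lipschitzWith_space t).lipschitzOnWith
      continuousOn := fun y _ ↦ (hw.lipschitzWith_time y).continuous.continuousOn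
      norm_le := fun t _ y _ ↦ hw.norm_le t y
      mul_max_le := by simp }
  exact hpl.exists_eq_forall_mem_Icc_hasDerivWithinAt₀

theorem IsLipschitzField.dist_trajectory_le (hw : IsLipschitzField w A K) {α β : ℝ → F}
    (hα : ∀ t ∈ Icc (0 : ℝ) 1, HasDerivWithinAt α (w t (α t)) (Icc 0 1) t)
    (hβ : ∀ t ∈ Icc (0 : ℝ) 1, HasDerivWithinAt β (w t (β t)) (Icc 0 1) t) {t : ℝ}
    (ht : t ∈ Icc (0 : ℝ) 1) : dist (α t) (β t) ≤ Real.exp A * dist (α 0) (β 0) := by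
  have hcont : ∀ {γ : ℝ → F}, (∀ t ∈ Icc (0 : ℝ) 1, HasDerivWithinAt γ (w t (γ t)) (Icc 0 1) t) →
      ContinuousOn γ (Icc 0 1) := fun hγ s hs ↦ (hγ s hs).continuousWithinAt
  have hright : ∀ {γ : ℝ → F}, (∀ t ∈ Icc (0 : ℝ) 1, HasDerivWithinAt γ (w t (γ t)) (Icc 0 1) t) →
      ∀ t ∈ Ico (0 : ℝ) 1, HasDerivWithinAt γ (w t (γ t)) (Ici t) t := fun hγ s hs ↦
    (hγ s (Ico_subset_Icc_self hs)).mono_of_mem_nhdsWithin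
      (mem_of_superset (Icc_mem_nhdsGE hs.2) (Icc_subset_Icc_left hs.1))
  refine (dist_le_of_trajectories_ODE hw.lipschitzWith_space (hcont hα) (hright hα) (hcont hβ)
    (hright hβ) le_rfl t ht).trans ?_
  rw [mul_comm, sub_zero]
  gcongr
  exact mul_le_of_le_one_right A.coe_nonneg ht.2

theorem IsLipschitzField.exists_isGlobalFlow [CompleteSpace F] (hw : IsLipschitzField w A K) :
    ∃ Φ, IsGlobalFlow w Φ := by
  choose α hα0 hα using hw.exists_trajectory
  have hlip : ∀ t ∈ Icc (0 : ℝ) 1, LipschitzOnWith ⟨Real.exp A, (Real.exp_pos _).le⟩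
      (fun x ↦ α x t) univ := fun t ht ↦ LipschitzOnWith.of_dist_le_mul fun x _ y _ ↦ by
    have hdist := hw.dist_trajectory_le (hα x) (hα y) ht
    rwa [hα0, hα0] at hdist
  have hjoint : ContinuousOn (Function.uncurry α) (univ ×ˢ Icc 0 1) :=
    continuousOn_prod_of_continuousOn_lipschitzOnWith _ _
      (fun x _ t ht ↦ (hα x t ht).continuousWithinAt) hlip
  refine ⟨fun t x ↦ α x (projIcc 0 1 zero_le_one t), ?_, fun x ↦ ?_, fun x t ht ↦ ?_⟩
  · exact hjoint.comp_continuous (f := fun z : ℝ × F ↦ (z.2, (projIcc 0 1 zero_le_one z.1 : ℝ)))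
      (by fun_prop) fun z ↦ ⟨mem_univ _, (projIcc 0 1 zero_le_one z.1).2⟩
  · simpa only [projIcc_left] using hα0 x
  · have hproj : ∀ s ∈ Icc (0 : ℝ) 1, α x (projIcc 0 1 zero_le_one s) = α x s := fun s hs ↦ by
      rw [projIcc_of_mem _ hs]
    simp only [hproj t ht]
    exact (hα x t ht).congr_of_mem hproj ht

namespace IsGlobalFlow

theorem continuous_apply (hΦ : IsGlobalFlow w Φ) (t : ℝ) : Continuous (Φ t) :=
  hΦ.continuous.comp (Continuous.prodMk_right t)

theorem lipschitzOnWith (hΦ : IsGlobalFlow w Φ) (hw : IsLipschitzField w A K) (x : F) :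
    LipschitzOnWith A (fun t ↦ Φ t x) (Icc 0 1) :=
  (convex_Icc 0 1).lipschitzOnWith_of_nnnorm_hasDerivWithin_le (hΦ.hasDerivWithinAt x)
    fun t _ ↦ hw.norm_le t _

theorem norm_field_sub_le (hΦ : IsGlobalFlow w Φ) (hw : IsLipschitzField w A K) (x : F) {t : ℝ}
    (ht : t ∈ Icc (0 : ℝ) 1) : ‖w t (Φ t x) - w 0 x‖ ≤ A ^ 2 + K := by
  have hmove : ‖Φ t x - x‖ ≤ A := by
    have h := (hΦ.lipschitzOnWith hw x).norm_sub_le ht (left_mem_Icc.2 zero_le_one)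
    rw [hΦ.initial, sub_zero, Real.norm_of_nonneg ht.1] at h
    exact h.trans (mul_le_of_le_one_right A.coe_nonneg ht.2)
  have htime : ‖w t x - w 0 x‖ ≤ K := by
    have h := (hw.lipschitzWith_time x).norm_sub_le t 0
    rw [sub_zero, Real.norm_of_nonneg ht.1] at h
    exact h.trans (mul_le_of_le_one_right K.coe_nonneg ht.2)
  calc ‖w t (Φ t x) - w 0 x‖
      ≤ ‖w t (Φ t x) - w t x‖ + ‖w t x - w 0 x‖ := norm_sub_le_norm_sub_add_norm_sub _ _ _
    _ ≤ A * A + K := add_le_add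
        (((hw.lipschitzWith_space t).norm_sub_le _ _).trans
          (mul_le_mul_of_nonneg_left hmove A.coe_nonneg)) htime
    _ = A ^ 2 + K := by ring

theorem norm_sub_id_sub_le (hΦ : IsGlobalFlow w Φ) (hw : IsLipschitzField w A K) (x : F) :
    ‖Φ 1 x - x - w 0 x‖ ≤ A ^ 2 + K := by
  have h := norm_image_sub_le_of_norm_deriv_le_segment_01' (f := fun s ↦ Φ s x - s • w 0 x)
    (fun s hs ↦ (hΦ.hasDerivWithinAt x s hs).sub
      (by simpa using (hasDerivWithinAt_id s _).smul_const (w 0 x)))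
    (fun s hs ↦ hΦ.norm_field_sub_le hw x (Ico_subset_Icc_self hs))
  simpa [hΦ.initial, sub_right_comm] using h

theorem integral_fderiv_trajectory (hΦ : IsGlobalFlow w Φ)
    (hw : Continuous (Function.uncurry w)) {φ : ℝ × F → ℝ} (hφ : ContDiff ℝ 1 φ) (x : F) :
    ∫ t in (0 : ℝ)..1, fderiv ℝ φ (t, Φ t x) (1, w t (Φ t x)) = φ (1, Φ 1 x) - φ (0, x) := by
  have hcurve : Continuous fun t ↦ (t, Φ t x) :=
    continuous_id.prodMk (hΦ.continuous.comp (Continuous.prodMk_left x))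
  have hder : ∀ t ∈ Ioo (0 : ℝ) 1, HasDerivAt (fun s ↦ φ (s, Φ s x))
      (fderiv ℝ φ (t, Φ t x) (1, w t (Φ t x))) t := fun t ht ↦
    (hφ.differentiable one_ne_zero _).hasFDerivAt.comp_hasDerivAt t ((hasDerivAt_id t).prodMk
      ((hΦ.hasDerivWithinAt x t (Ioo_subset_Icc_self ht)).hasDerivAt (Icc_mem_nhds ht.1 ht.2)))
  have hint : Continuous fun t ↦ fderiv ℝ φ (t, Φ t x) (1, w t (Φ t x)) :=
    ((hφ.continuous_fderiv one_ne_zero).comp hcurve).clm_apply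
      (continuous_const.prodMk (hw.comp hcurve))
  rw [intervalIntegral.integral_eq_sub_of_hasDerivAt_of_le zero_le_one
    (f := fun s ↦ φ (s, Φ s x)) (hφ.continuous.comp hcurve).continuousOn hder
    (hint.intervalIntegrable _ _), hΦ.initial]

end IsGlobalFlow

section Euclidean

variable {d : ℕ} {w Φ : ℝ → Euc d → Euc d} {A K : ℝ≥0} {Ω : Set (Euc d)}

theorem IsGlobalFlow.isFlow (hΦ : IsGlobalFlow w Φ) (hw : IsLipschitzField w A K)
    {v : ℝ → Euc d → Euc d} (hv : EqOn w v (Icc 0 1)) : IsFlow Ω v Φ where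
  continuousOn t _ := (hΦ.continuous_apply t).continuousOn
  absCont x _ := LipschitzOnWith.absolutelyContinuousOnInterval
    (uIcc_of_le (zero_le_one (α := ℝ)) ▸ hΦ.lipschitzOnWith hw x)
  initial x _ := hΦ.initial x
  ode := by
    rw [← restrict_Ioo_eq_restrict_Icc]
    filter_upwards [ae_restrict_mem measurableSet_Ioo] with t ht x _
    rw [← hv (Ioo_subset_Icc_self ht)]
    exact (hΦ.hasDerivWithinAt x t (Ioo_subset_Icc_self ht)).hasDerivAt (Icc_mem_nhds ht.1 ht.2)

theorem IsGlobalFlow.isContinuityEq (hΦ : IsGlobalFlow w Φ) (hw : IsLipschitzField w A K)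
    (hΩ : IsCompact Ω) {μ : Measure (Euc d)} [IsFiniteMeasure μ] (hμ : μ Ωᶜ = 0)
    {ρ : ℝ → Measure (Euc d)} (hρ : ∀ t ∈ Icc (0 : ℝ) 1, ρ t = μ.map (Φ t)) :
    IsContinuityEq ρ w := by
  refine ⟨hw.continuous.measurable, fun t ht ↦ ?_, fun φ hφ ↦ ?_⟩
  · rw [hρ t ht]
    exact MemLp.of_bound (hw.lipschitzWith_space t).continuous.aestronglyMeasurable A
      (ae_of_all _ (hw.norm_le t))
  have hswap : ∀ {a : ℝ × Euc d → ℝ × Euc d}, Continuous a →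
      (∫ t in (0 : ℝ)..1, ∫ x, fderiv ℝ φ (t, x) (a (t, x)) ∂(ρ t)) =
        ∫ x, (∫ t in (0 : ℝ)..1, fderiv ℝ φ (t, Φ t x) (a (t, Φ t x))) ∂μ := by
    intro a ha
    rw [← intervalIntegral_integral_map_swap hΩ hμ hΦ.continuous
      (g := fun z ↦ fderiv ℝ φ z (a z)) ((hφ.continuous_fderiv one_ne_zero).clm_apply ha)]
    refine intervalIntegral.integral_congr fun t ht ↦ ?_
    rw [uIcc_of_le zero_le_one] at ht
    simp only [hρ t ht]
  have hcont : ∀ {a : ℝ × Euc d → ℝ × Euc d}, Continuous a →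
      Continuous (Function.uncurry fun x t ↦ fderiv ℝ φ (t, Φ t x) (a (t, Φ t x))) := by
    intro a ha
    have hcurve : Continuous fun z : Euc d × ℝ ↦ (z.2, Φ z.2 z.1) :=
      continuous_snd.prodMk (hΦ.continuous.comp continuous_swap)
    exact ((hφ.continuous_fderiv one_ne_zero).comp hcurve).clm_apply (ha.comp hcurve)
  have hend : ∀ t ∈ Icc (0 : ℝ) 1, Integrable (fun x ↦ φ (t, Φ t x)) μ ∧
      ∫ x, φ (t, x) ∂(ρ t) = ∫ x, φ (t, Φ t x) ∂μ := by
    intro t ht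
    have hΦt := hΦ.continuous_apply t
    refine ⟨integrable_of_isCompact hΩ hμ
      (hφ.continuous.comp (continuous_const.prodMk hΦt)).continuousOn, ?_⟩
    rw [hρ t ht]
    exact integral_map hΦt.aemeasurable
      (hφ.continuous.comp (Continuous.prodMk_right t)).aestronglyMeasurable
  have htime : Continuous fun _ : ℝ × Euc d ↦ ((1, 0) : ℝ × Euc d) := continuous_const
  have hspace : Continuous fun z : ℝ × Euc d ↦ ((0, w z.1 z.2) : ℝ × Euc d) :=
    continuous_const.prodMk hw.continuous
  have h0 := hend 0 (left_mem_Icc.2 zero_le_one)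
  have h1 := hend 1 (right_mem_Icc.2 zero_le_one)
  rw [hswap htime, hswap hspace, integral_intervalIntegral_add hΩ hμ (hcont htime) (hcont hspace),
    h0.2, h1.2, ← integral_sub h1.1 h0.1]
  simp only [← map_add, Prod.mk_add_mk, add_zero, zero_add, hΦ.initial,
    hΦ.integral_fderiv_trajectory hw.continuous hφ]

end Euclidean

end Flow

section Duality

theorem exists_measure_integral_eq_of_nonneg {X : Type*} [TopologicalSpace X] [CompactSpace X]
    [T2Space X] [MeasurableSpace X] [BorelSpace X] (g : C(X, ℝ) →ₗ[ℝ] ℝ)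
    (hg : ∀ f, 0 ≤ f → 0 ≤ g f) :
    ∃ p : Measure X, IsFiniteMeasure p ∧ ∀ f : C(X, ℝ), ∫ x, f x ∂p = g f := by
  let G : CompactlySupportedContinuousMap X ℝ →ₗ[ℝ] ℝ :=
    { toFun := fun f ↦ g f.toContinuousMap
      map_add' := fun _ _ ↦ g.map_add _ _
      map_smul' := fun _ _ ↦ g.map_smul _ _ }
  exact ⟨RealRMK.rieszMeasure (PositiveLinearMap.mk₀ G fun f hf ↦ hg _ hf), inferInstance,
    fun f ↦ RealRMK.integral_rieszMeasure _ ⟨f, HasCompactSupport.of_compactSpace f⟩⟩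

theorem map_eq_of_forall_integral_le {Z X : Type*} [TopologicalSpace Z] [MeasurableSpace Z]
    [OpensMeasurableSpace Z] [TopologicalSpace X] [HasOuterApproxClosed X] [MeasurableSpace X]
    [BorelSpace X] {p : Measure Z} [IsFiniteMeasure p] {μ : Measure X} [IsFiniteMeasure μ]
    (f : C(Z, X)) (h : ∀ φ : C(X, ℝ), ∫ z, φ (f z) ∂p ≤ ∫ x, φ x ∂μ) : p.map f = μ := by
  refine ext_of_forall_integral_eq_of_IsFiniteMeasure fun φ ↦ ?_
  rw [integral_map f.continuous.aemeasurable φ.continuous.aestronglyMeasurable]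
  refine le_antisymm (h φ) (neg_le_neg_iff.1 ?_)
  have hneg := h (-φ.toContinuousMap)
  simp only [ContinuousMap.neg_apply, integral_neg] at hneg
  exact hneg

variable {X Y : Type*} [MetricSpace X] [MeasurableSpace X] [MetricSpace Y] [MeasurableSpace Y]
  {μ : Measure X} {ν : Measure Y} {c f g : C(X × Y, ℝ)} {T r q : ℝ}

/-- `T` is an upper bound for the dual Kantorovich problem with cost `c`. -/
def IsDualBound (μ : Measure X) (ν : Measure Y) (c : C(X × Y, ℝ)) (T : ℝ) : Prop :=
  ∀ (φ : C(X, ℝ)) (ψ : C(Y, ℝ)), (∀ x y, φ x + ψ y ≤ c (x, y)) →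
    ∫ x, φ x ∂μ + ∫ y, ψ y ∂ν ≤ T

/-- The upper bounds of `∫ f dp` obtained from `f ≤ φ ⊕ ψ + s c`, for a coupling `p` of `μ` and `ν`
with cost at most `T`. -/
def dualValues (μ : Measure X) (ν : Measure Y) (c : C(X × Y, ℝ)) (T : ℝ) (f : C(X × Y, ℝ)) :
    Set ℝ :=
  {r | ∃ (φ : C(X, ℝ)) (ψ : C(Y, ℝ)) (s : ℝ), 0 ≤ s ∧
    (∀ x y, f (x, y) ≤ φ x + ψ y + s * c (x, y)) ∧ r = ∫ x, φ x ∂μ + ∫ y, ψ y ∂ν + s * T}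

theorem smul_mem_dualValues {a : ℝ} (ha : 0 ≤ a) (hr : r ∈ dualValues μ ν c T f) :
    a * r ∈ dualValues μ ν c T (a • f) := by
  obtain ⟨φ, ψ, s, hs, hle, rfl⟩ := hr
  refine ⟨a • φ, a • ψ, a * s, mul_nonneg ha hs, fun x y ↦ ?_, ?_⟩
  · have hle' := mul_le_mul_of_nonneg_left (hle x y) ha
    simp only [ContinuousMap.smul_apply, smul_eq_mul]
    linarith
  · simp only [ContinuousMap.smul_apply, smul_eq_mul, integral_const_mul]
    ring

variable [CompactSpace X] [CompactSpace Y]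

theorem norm_mem_dualValues [IsProbabilityMeasure μ] : ‖f‖ ∈ dualValues μ ν c T f :=
  ⟨ContinuousMap.const X ‖f‖, 0, 0, le_rfl,
    fun x y ↦ by simpa using (le_abs_self _).trans (f.norm_coe_le_norm (x, y)), by simp⟩

variable [BorelSpace X] [BorelSpace Y]

theorem add_mem_dualValues [IsFiniteMeasure μ] [IsFiniteMeasure ν]
    (hr : r ∈ dualValues μ ν c T f) (hq : q ∈ dualValues μ ν c T g) :
    r + q ∈ dualValues μ ν c T (f + g) := by
  obtain ⟨φ, ψ, s, hs, hle, rfl⟩ := hr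
  obtain ⟨φ', ψ', s', hs', hle', rfl⟩ := hq
  refine ⟨φ + φ', ψ + ψ', s + s', add_nonneg hs hs', fun x y ↦ ?_, ?_⟩
  · simp only [ContinuousMap.add_apply]
    linarith [hle x y, hle' x y]
  · simp only [ContinuousMap.add_apply]
    rw [integral_add (φ.continuous.integrable_of_hasCompactSupport (.of_compactSpace φ))
        (φ'.continuous.integrable_of_hasCompactSupport (.of_compactSpace φ')),
      integral_add (ψ.continuous.integrable_of_hasCompactSupport (.of_compactSpace ψ))
        (ψ'.continuous.integrable_of_hasCompactSupport (.of_compactSpace ψ'))]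
    ring

variable [IsProbabilityMeasure μ] [IsProbabilityMeasure ν]

theorem le_integral_add_integral {φ : C(X, ℝ)} {ψ : C(Y, ℝ)} (h : ∀ x y, r ≤ φ x + ψ y) :
    r ≤ ∫ x, φ x ∂μ + ∫ y, ψ y ∂ν := by
  have hφ : Integrable (fun z : X × Y ↦ φ z.1) (μ.prod ν) :=
    (φ.continuous.integrable_of_hasCompactSupport (.of_compactSpace φ)).comp_fst ν
  have hψ : Integrable (fun z : X × Y ↦ ψ z.2) (μ.prod ν) :=
    (ψ.continuous.integrable_of_hasCompactSupport (.of_compactSpace ψ)).comp_snd μ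
  calc r = ∫ _z, r ∂(μ.prod ν) := by simp
    _ ≤ ∫ z, (φ z.1 + ψ z.2) ∂(μ.prod ν) :=
        integral_mono (integrable_const r) (hφ.add hψ) fun z ↦ h z.1 z.2
    _ = ∫ x, φ x ∂μ + ∫ y, ψ y ∂ν := by
        rw [integral_add hφ hψ, integral_fun_fst, integral_fun_snd]
        simp

namespace IsDualBound

theorem le_mul (hT : IsDualBound μ ν c T) {φ : C(X, ℝ)} {ψ : C(Y, ℝ)} {s : ℝ} (hs : 0 ≤ s)
    (h : ∀ x y, φ x + ψ y ≤ s * c (x, y)) : ∫ x, φ x ∂μ + ∫ y, ψ y ∂ν ≤ s * T := by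
  rcases hs.eq_or_lt with rfl | hs
  · have hneg := le_integral_add_integral (μ := μ) (ν := ν) (φ := -φ) (ψ := -ψ) (r := 0)
      fun x y ↦ by
        have := h x y
        simp only [ContinuousMap.neg_apply]
        linarith
    simp only [ContinuousMap.neg_apply, integral_neg] at hneg
    linarith
  · have hscaled := hT (s⁻¹ • φ) (s⁻¹ • ψ) fun x y ↦ by
      simpa only [ContinuousMap.smul_apply, smul_eq_mul, ← mul_add, inv_mul_le_iff₀ hs] using h x y
    simpa only [ContinuousMap.smul_apply, smul_eq_mul, integral_const_mul, ← mul_add,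
      inv_mul_le_iff₀ hs] using hscaled

theorem nonneg_of_mem_dualValues_zero (hT : IsDualBound μ ν c T)
    (hr : r ∈ dualValues μ ν c T 0) : 0 ≤ r := by
  obtain ⟨φ, ψ, s, hs, hle, rfl⟩ := hr
  have hbound := hT.le_mul (φ := -φ) (ψ := -ψ) hs fun x y ↦ by
    have := hle x y
    simp only [ContinuousMap.zero_apply, ContinuousMap.neg_apply] at this ⊢
    linarith
  simp only [ContinuousMap.neg_apply, integral_neg] at hbound
  linarith

theorem bddBelow_dualValues (hT : IsDualBound μ ν c T) : BddBelow (dualValues μ ν c T f) := by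
  refine ⟨-‖-f‖, fun r hr ↦ ?_⟩
  have hzero := add_mem_dualValues hr (norm_mem_dualValues (f := -f))
  rw [add_neg_cancel] at hzero
  linarith [hT.nonneg_of_mem_dualValues_zero hzero]

theorem sInf_dualValues_smul_le (hT : IsDualBound μ ν c T) {a : ℝ} (ha : 0 < a) :
    sInf (dualValues μ ν c T (a • f)) ≤ a * sInf (dualValues μ ν c T f) := by
  rw [← div_le_iff₀' ha]
  refine le_csInf ⟨_, norm_mem_dualValues⟩ fun r hr ↦ ?_
  rw [div_le_iff₀' ha]
  exact csInf_le hT.bddBelow_dualValues (smul_mem_dualValues ha.le hr)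

theorem sInf_dualValues_smul (hT : IsDualBound μ ν c T) {a : ℝ} (ha : 0 < a) :
    sInf (dualValues μ ν c T (a • f)) = a * sInf (dualValues μ ν c T f) := by
  refine le_antisymm (hT.sInf_dualValues_smul_le ha) ?_
  have hinv := hT.sInf_dualValues_smul_le (f := a • f) (inv_pos.2 ha)
  rwa [smul_smul, inv_mul_cancel₀ ha.ne', one_smul, le_inv_mul_iff₀ ha] at hinv

theorem sInf_dualValues_add_le (hT : IsDualBound μ ν c T) :
    sInf (dualValues μ ν c T (f + g)) ≤
      sInf (dualValues μ ν c T f) + sInf (dualValues μ ν c T g) := by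
  rw [← sub_le_iff_le_add]
  refine le_csInf ⟨_, norm_mem_dualValues⟩ fun r hr ↦ ?_
  rw [sub_le_comm]
  refine le_csInf ⟨_, norm_mem_dualValues⟩ fun q hq ↦ ?_
  rw [sub_le_iff_le_add']
  exact csInf_le hT.bddBelow_dualValues (add_mem_dualValues hr hq)

theorem exists_linearMap_le (hT : IsDualBound μ ν c T) :
    ∃ l : C(X × Y, ℝ) →ₗ[ℝ] ℝ, ∀ f, ∀ r ∈ dualValues μ ν c T f, l f ≤ r := by
  obtain ⟨l, -, hl⟩ := exists_extension_of_le_sublinear (⊥ : C(X × Y, ℝ) →ₗ.[ℝ] ℝ)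
    (fun f ↦ sInf (dualValues μ ν c T f)) (fun a ha f ↦ hT.sInf_dualValues_smul ha)
    (fun f g ↦ hT.sInf_dualValues_add_le) (by
      rintro ⟨f, hf⟩
      obtain rfl : f = 0 := (Submodule.mem_bot ℝ).1 hf
      exact (LinearPMap.map_zero _).trans_le
        (Real.sInf_nonneg fun r hr ↦ hT.nonneg_of_mem_dualValues_zero hr))
  exact ⟨l, fun f r hr ↦ (hl f).trans (csInf_le hT.bddBelow_dualValues hr)⟩

/-- Kantorovich duality by Hahn–Banach: a linear functional below `f ↦ inf (dualValues μ ν c T f)`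
is positive, hence integration against a measure, and this measure is the coupling. -/
theorem exists_coupling (hT : IsDualBound μ ν c T) :
    ∃ p : Measure (X × Y), IsFiniteMeasure p ∧ p.fst = μ ∧ p.snd = ν ∧ ∫ z, c z ∂p ≤ T := by
  obtain ⟨l, hl⟩ := hT.exists_linearMap_le
  obtain ⟨p, hpfin, hp⟩ := exists_measure_integral_eq_of_nonneg l fun f hf ↦ by
    have hneg := hl (-f) 0 ⟨0, 0, 0, le_rfl, fun x y ↦ by simpa using hf (x, y), by simp⟩
    rwa [map_neg, neg_nonpos] at hneg
  refine ⟨p, hpfin, ?_, ?_, ?_⟩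
  · refine map_eq_of_forall_integral_le (⟨Prod.fst, continuous_fst⟩ : C(X × Y, X)) fun φ ↦ ?_
    exact (hp (φ.comp ⟨Prod.fst, continuous_fst⟩)).trans_le
      (hl _ _ ⟨φ, 0, 0, le_rfl, fun x y ↦ by simp, by simp⟩)
  · refine map_eq_of_forall_integral_le (⟨Prod.snd, continuous_snd⟩ : C(X × Y, Y)) fun ψ ↦ ?_
    exact (hp (ψ.comp ⟨Prod.snd, continuous_snd⟩)).trans_le
      (hl _ _ ⟨0, ψ, 0, le_rfl, fun x y ↦ by simp, by simp⟩)
  · rw [hp]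
    exact hl _ _ ⟨0, 0, 1, zero_le_one, fun x y ↦ by simp, by simp⟩

end IsDualBound

end Duality

section Wasserstein

theorem rpow_half_sq (x : ℝ≥0∞) : (x ^ (1 / 2 : ℝ)) ^ 2 = x := by
  rw [← ENNReal.rpow_natCast, ← ENNReal.rpow_mul]
  norm_num

theorem lintegral_enorm_sq_le {X F : Type*} [MeasurableSpace X] [NormedAddCommGroup F]
    {p : Measure X} [IsProbabilityMeasure p] {f : X → F} (hf : AEStronglyMeasurable f p) :
    (∫⁻ x, ‖f x‖ₑ ∂p) ^ 2 ≤ ∫⁻ x, ‖f x‖ₑ ^ 2 ∂p := by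
  have hle := eLpNorm_le_eLpNorm_of_exponent_le (one_le_two (α := ℝ≥0∞)) hf
  rw [eLpNorm_one_eq_lintegral_enorm, eLpNorm_eq_lintegral_rpow_enorm_toReal two_ne_zero
    ENNReal.ofNat_ne_top] at hle
  simp only [ENNReal.toReal_ofNat, ENNReal.rpow_ofNat] at hle
  calc (∫⁻ x, ‖f x‖ₑ ∂p) ^ 2 ≤ ((∫⁻ x, ‖f x‖ₑ ^ 2 ∂p) ^ (1 / 2 : ℝ)) ^ 2 := by gcongr
    _ = ∫⁻ x, ‖f x‖ₑ ^ 2 ∂p := rpow_half_sq _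

theorem ofReal_integral_le_lintegral_ofReal {X : Type*} [MeasurableSpace X] {p : Measure X}
    {f : X → ℝ} (hf : Integrable f p) :
    ENNReal.ofReal (∫ x, f x ∂p) ≤ ∫⁻ x, ENNReal.ofReal (f x) ∂p := by
  refine ENNReal.ofReal_le_of_le_toReal ?_
  rw [integral_eq_lintegral_pos_part_sub_lintegral_neg_part hf]
  exact sub_le_self _ ENNReal.toReal_nonneg

theorem isProbabilityMeasure_of_fst {X Y : Type*} [MeasurableSpace X] [MeasurableSpace Y]
    (p : Measure (X × Y)) [IsProbabilityMeasure p.fst] : IsProbabilityMeasure p :=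
  ⟨Measure.fst_univ.symm.trans measure_univ⟩

theorem map_val_comap_val_of_compl_null {X : Type*} [MeasurableSpace X] {Ω : Set X}
    (hΩ : MeasurableSet Ω) {μ : Measure X} (hμ : μ Ωᶜ = 0) :
    (μ.comap (Subtype.val : Ω → X)).map Subtype.val = μ := by
  rw [map_comap_subtype_coe hΩ, Measure.restrict_eq_self_of_ae_mem hμ]

variable {d : ℕ} {μ ν : Measure (Euc d)} {Ω : Set (Euc d)}

theorem W_sq (μ ν : Measure (Euc d)) : W μ ν ^ 2 =
    ⨅ (p : Measure (Euc d × Euc d)) (_ : p.fst = μ ∧ p.snd = ν), ∫⁻ z, ‖z.1 - z.2‖ₑ ^ 2 ∂p := by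
  rw [W, rpow_half_sq]

theorem lintegral_le_add_mul_lintegral_enorm_sub {p : Measure (Euc d × Euc d)}
    {f : Euc d → ℝ≥0} {L : ℝ≥0} (hf : LipschitzWith L f) :
    ∫⁻ x, f x ∂p.fst ≤ ∫⁻ x, f x ∂p.snd + L * ∫⁻ z, ‖z.1 - z.2‖ₑ ∂p := by
  have hfm : Measurable fun x ↦ (f x : ℝ≥0∞) := hf.continuous.measurable.coe_nnreal_ennreal
  have hfm₂ : Measurable fun z : Euc d × Euc d ↦ (f z.2 : ℝ≥0∞) := hfm.comp measurable_snd
  rw [Measure.fst, Measure.snd, lintegral_map hfm measurable_fst, lintegral_map hfm measurable_snd,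
    ← lintegral_const_mul _ (by fun_prop), ← lintegral_add_left hfm₂]
  refine lintegral_mono fun z ↦ ?_
  calc (f z.1 : ℝ≥0∞) ≤ f z.2 + edist (f z.1) (f z.2) := by
        rw [edist_nndist]
        exact_mod_cast NNReal.le_add_nndist _ _
    _ ≤ f z.2 + L * ‖z.1 - z.2‖ₑ := by
        gcongr
        exact (hf z.1 z.2).trans_eq (by rw [edist_eq_enorm_sub])

theorem lintegral_le_add_mul_W [IsProbabilityMeasure μ] {f : Euc d → ℝ≥0} {L : ℝ≥0}
    (hL : L ≠ 0) (hf : LipschitzWith L f) :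
    ∫⁻ x, f x ∂μ ≤ ∫⁻ x, f x ∂ν + L * W μ ν := by
  have hL' : (L : ℝ≥0∞) ≠ 0 := ENNReal.coe_ne_zero.2 hL
  rw [← tsub_le_iff_left, ← ENNReal.div_le_iff' hL' ENNReal.coe_ne_top,
    ← ENNReal.pow_le_pow_left_iff two_ne_zero, W_sq]
  refine le_iInf₂ fun p ⟨hp₁, hp₂⟩ ↦ ?_
  subst hp₁ hp₂
  have := isProbabilityMeasure_of_fst p
  refine le_trans ?_ (lintegral_enorm_sq_le (f := fun z : Euc d × Euc d ↦ z.1 - z.2)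
    (by fun_prop))
  gcongr
  rw [ENNReal.div_le_iff' hL' ENNReal.coe_ne_top, tsub_le_iff_left]
  exact lintegral_le_add_mul_lintegral_enorm_sub hf

theorem measurable_of_W_le {ρ : ℝ → Measure (Euc d)} [∀ t, IsProbabilityMeasure (ρ t)] {K : ℝ≥0}
    (hρ : ∀ s t, W (ρ s) (ρ t) ≤ K * edist s t) : Measurable ρ := by
  refine Measurable.measure_of_isPiSystem_of_isProbabilityMeasure
    (BorelSpace.measurable_eq.trans borel_eq_generateFrom_isClosed) isPiSystem_isClosed ?_
  intro F hF
  have hpos : ∀ n : ℕ, (0 : ℝ) < 1 / ((n : ℝ) + 1) := fun n ↦ by positivity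
  refine measurable_of_tendsto_metrizable (f := fun (n : ℕ) t ↦
    ∫⁻ x, thickenedIndicator (hpos n) F x ∂(ρ t)) (fun n ↦ ?_)
    (tendsto_pi_nhds.2 fun t ↦ tendsto_lintegral_thickenedIndicator_of_isClosed (ρ t) hF hpos
      tendsto_one_div_add_atTop_nhds_zero_nat)
  obtain ⟨L, hL0, hL⟩ : ∃ L : ℝ≥0, L ≠ 0 ∧ LipschitzWith L (thickenedIndicator (hpos n) F) :=
    ⟨_, (add_pos_of_nonneg_of_pos zero_le one_pos).ne',
      (lipschitzWith_thickenedIndicator (hpos n) F).weaken le_self_add⟩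
  refine (continuous_of_le_add_edist (L * K : ℝ≥0∞) (by finiteness) fun s t ↦ ?_).measurable
  refine (lintegral_le_add_mul_W (ν := ρ t) hL0 hL).trans ?_
  rw [mul_assoc]
  gcongr
  exact hρ s t

theorem ofReal_integral_add_integral_le_W_sq (hμ : μ Ωᶜ = 0) (hν : ν Ωᶜ = 0)
    {φ ψ : Euc d → ℝ} (hφ : Integrable φ μ) (hψ : Integrable ψ ν)
    (h : ∀ x ∈ Ω, ∀ y ∈ Ω, φ x + ψ y ≤ ‖x - y‖ ^ 2) :
    ENNReal.ofReal (∫ x, φ x ∂μ + ∫ y, ψ y ∂ν) ≤ W μ ν ^ 2 := by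
  rw [W_sq]
  refine le_iInf₂ fun p ⟨hp₁, hp₂⟩ ↦ ?_
  subst hp₁ hp₂
  have hφp : Integrable (fun z : Euc d × Euc d ↦ φ z.1) p := hφ.comp_measurable measurable_fst
  have hψp : Integrable (fun z : Euc d × Euc d ↦ ψ z.2) p := hψ.comp_measurable measurable_snd
  have hfst : ∀ᵐ z ∂p, z.1 ∈ Ω := ae_of_ae_map measurable_fst.aemeasurable hμ
  have hsnd : ∀ᵐ z ∂p, z.2 ∈ Ω := ae_of_ae_map measurable_snd.aemeasurable hν
  rw [Measure.fst, Measure.snd, integral_map measurable_fst.aemeasurable hφ.1,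
    integral_map measurable_snd.aemeasurable hψ.1, ← integral_add hφp hψp]
  refine (ofReal_integral_le_lintegral_ofReal (hφp.add hψp)).trans ?_
  refine lintegral_mono_ae ?_
  filter_upwards [hfst, hsnd] with z hz₁ hz₂
  rw [← ofReal_norm, ← ENNReal.ofReal_pow (norm_nonneg _)]
  exact ENNReal.ofReal_le_ofReal (h _ hz₁ _ hz₂)

theorem W_sq_le_of_coupling_comap (hΩ : MeasurableSet Ω) (hμ : μ Ωᶜ = 0) (hν : ν Ωᶜ = 0)
    {p : Measure (Ω × Ω)} (hp₁ : p.fst = μ.comap Subtype.val) (hp₂ : p.snd = ν.comap Subtype.val) :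
    W μ ν ^ 2 ≤ ∫⁻ z, ‖(z.1 : Euc d) - z.2‖ₑ ^ 2 ∂p := by
  have hval : Measurable (Prod.map Subtype.val Subtype.val : Ω × Ω → Euc d × Euc d) := by fun_prop
  rw [W_sq]
  refine iInf₂_le_of_le (p.map (Prod.map Subtype.val Subtype.val)) ⟨?_, ?_⟩ ?_
  · rw [← map_val_comap_val_of_compl_null hΩ hμ, ← hp₁, Measure.fst, Measure.fst,
      Measure.map_map measurable_fst hval, Measure.map_map measurable_subtype_coe measurable_fst]
    rfl
  · rw [← map_val_comap_val_of_compl_null hΩ hν, ← hp₂, Measure.snd, Measure.snd,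
      Measure.map_map measurable_snd hval, Measure.map_map measurable_subtype_coe measurable_snd]
    rfl
  · rw [lintegral_map (by fun_prop) hval]
    rfl

theorem W_sq_le_of_dual (hΩ : IsCompact Ω) [IsProbabilityMeasure μ] [IsProbabilityMeasure ν]
    (hμ : μ Ωᶜ = 0) (hν : ν Ωᶜ = 0) {T : ℝ}
    (hdual : ∀ φ ψ : C(Euc d, ℝ), (∀ x ∈ Ω, ∀ y ∈ Ω, φ x + ψ y ≤ ‖x - y‖ ^ 2) →
      ∫ x, φ x ∂μ + ∫ y, ψ y ∂ν ≤ T) : W μ ν ^ 2 ≤ ENNReal.ofReal T := by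
  have hΩm := hΩ.measurableSet
  have : CompactSpace Ω := isCompact_iff_compactSpace.1 hΩ
  have hprob : ∀ {μ : Measure (Euc d)} [IsProbabilityMeasure μ], μ Ωᶜ = 0 →
      IsProbabilityMeasure (μ.comap (Subtype.val : Ω → Euc d)) := fun {μ} _ h ↦ by
    constructor
    rw [comap_subtype_coe_apply hΩm, image_univ, Subtype.range_coe]
    exact (prob_compl_eq_zero_iff hΩm).1 h
  have := hprob hμ
  have := hprob hν
  have hcomap : ∀ {μ : Measure (Euc d)}, μ Ωᶜ = 0 → ∀ φ : C(Euc d, ℝ),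
      ∫ x, φ x ∂μ = ∫ x, φ.restrict Ω x ∂(μ.comap Subtype.val) := fun {μ} h φ ↦ by
    conv_lhs => rw [← map_val_comap_val_of_compl_null hΩm h]
    exact integral_map measurable_subtype_coe.aemeasurable φ.continuous.aestronglyMeasurable
  let c : C(Ω × Ω, ℝ) := ⟨fun z ↦ ‖(z.1 : Euc d) - z.2‖ ^ 2, by fun_prop⟩
  have hT : IsDualBound (μ.comap Subtype.val) (ν.comap Subtype.val) c T := fun φ ψ h ↦ by
    obtain ⟨φ, rfl⟩ := φ.exists_restrict_eq hΩ.isClosed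
    obtain ⟨ψ, rfl⟩ := ψ.exists_restrict_eq hΩ.isClosed
    rw [← hcomap hμ, ← hcomap hν]
    exact hdual φ ψ fun x hx y hy ↦ h ⟨x, hx⟩ ⟨y, hy⟩
  obtain ⟨p, _, hp₁, hp₂, hpT⟩ := hT.exists_coupling
  refine (W_sq_le_of_coupling_comap hΩm hμ hν hp₁ hp₂).trans ?_
  refine (Eq.trans_le ?_ (ENNReal.ofReal_le_ofReal hpT))
  rw [ofReal_integral_eq_lintegral_ofReal
    (c.continuous.integrable_of_hasCompactSupport (.of_compactSpace c))
    (ae_of_all _ fun z ↦ sq_nonneg _)]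
  refine lintegral_congr fun z ↦ ?_
  simp only [c, ContinuousMap.coe_mk, ENNReal.ofReal_pow (norm_nonneg _), ofReal_norm]

end Wasserstein

section SoftMin

variable {ι : Type*} {ε k : ℝ} {s : Finset ι} {a b : ι → ℝ} {i : ι}

/-- A smooth approximation of the minimum of `a` over `s`, up to an error `ε log |s|`. -/
def softMin (ε : ℝ) (s : Finset ι) (a : ι → ℝ) : ℝ :=
  -ε * Real.log (∑ i ∈ s, Real.exp (-a i / ε))

theorem sum_exp_pos (hs : s.Nonempty) : 0 < ∑ i ∈ s, Real.exp (a i) :=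
  Finset.sum_pos (fun _ _ ↦ Real.exp_pos _) hs

theorem softMin_le_add (hε : 0 < ε) (hs : s.Nonempty) (h : ∀ i ∈ s, b i ≤ a i + k) :
    softMin ε s b ≤ softMin ε s a + k := by
  have hsum : Real.exp (-k / ε) * ∑ i ∈ s, Real.exp (-a i / ε) ≤ ∑ i ∈ s, Real.exp (-b i / ε) := by
    rw [Finset.mul_sum]
    refine Finset.sum_le_sum fun i hi ↦ ?_
    rw [← Real.exp_add, ← add_div]
    gcongr
    linarith [h i hi]
  have hlog := Real.log_le_log (mul_pos (Real.exp_pos _) (sum_exp_pos hs)) hsum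
  rw [Real.log_mul (Real.exp_pos _).ne' (sum_exp_pos hs).ne', Real.log_exp] at hlog
  have hmul := mul_le_mul_of_nonneg_left hlog hε.le
  rw [mul_add, mul_div_cancel₀ _ hε.ne'] at hmul
  unfold softMin
  linarith

theorem softMin_le (hε : 0 < ε) (hi : i ∈ s) : softMin ε s a ≤ a i := by
  have hlog := Real.log_le_log (Real.exp_pos _)
    (Finset.single_le_sum (f := fun i ↦ Real.exp (-a i / ε)) (fun _ _ ↦ (Real.exp_pos _).le) hi)
  rw [Real.log_exp] at hlog
  have hmul := mul_le_mul_of_nonneg_left hlog hε.le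
  rw [mul_div_cancel₀ _ hε.ne'] at hmul
  unfold softMin
  linarith

theorem le_softMin (hε : 0 < ε) (hs : s.Nonempty) (h : ∀ i ∈ s, k ≤ a i) :
    k - ε * Real.log s.card ≤ softMin ε s a := by
  have hzero : softMin ε s 0 = -ε * Real.log s.card := by simp [softMin]
  have hle := softMin_le_add (a := a) (b := 0) (k := -k) hε hs fun i hi ↦ by
    rw [Pi.zero_apply]
    linarith [h i hi]
  linarith

end SoftMin

section HopfLax

variable {F : Type*} [NormedAddCommGroup F]

theorem norm_add_smul_sq_div_le [NormedSpace ℝ F] (q p : F) {τ h : ℝ} (hτ : 0 < τ) (hh : 0 ≤ h) :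
    ‖q + h • p‖ ^ 2 / (τ + h) ≤ ‖q‖ ^ 2 / τ + h * ‖p‖ ^ 2 := by
  have hdefect : (‖q‖ ^ 2 / τ + h * ‖p‖ ^ 2) * (τ + h) =
      (‖q‖ + h * ‖p‖) ^ 2 + h * (‖q‖ - τ * ‖p‖) ^ 2 / τ := by field_simp; ring
  have htriangle : ‖q + h • p‖ ≤ ‖q‖ + h * ‖p‖ := by
    simpa only [norm_smul, Real.norm_of_nonneg hh] using norm_add_le q (h • p)
  rw [div_le_iff₀ (by positivity), hdefect]
  exact (pow_le_pow_left₀ (norm_nonneg _) htriangle 2).trans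
    (le_add_of_nonneg_right (by positivity))

/-- A smooth positive function of time that equals `δ + t` for `t ≥ 0`. -/
def smoothShift (δ t : ℝ) : ℝ := δ + t * Real.smoothTransition (1 + t / δ)

variable {δ ε : ℝ}

theorem contDiff_smoothShift : ContDiff ℝ 1 (smoothShift δ) :=
  contDiff_const.add (contDiff_id.mul
    (Real.smoothTransition.contDiff.comp (contDiff_const.add (contDiff_id.div_const δ))))

theorem smoothShift_of_nonneg (hδ : 0 < δ) {t : ℝ} (ht : 0 ≤ t) : smoothShift δ t = δ + t := by
  rw [smoothShift, Real.smoothTransition.one_of_one_le (le_add_of_nonneg_right (by positivity)),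
    mul_one]

theorem smoothShift_pos (hδ : 0 < δ) (t : ℝ) : 0 < smoothShift δ t := by
  rcases le_or_gt 0 t with ht | ht
  · rw [smoothShift_of_nonneg hδ ht]
    positivity
  rcases le_or_gt t (-δ) with htδ | htδ
  · have harg : 1 + t / δ ≤ 0 := by
      have := (div_le_iff₀ hδ).2 (htδ.trans_eq (neg_one_mul δ).symm)
      linarith
    rwa [smoothShift, Real.smoothTransition.zero_of_nonpos harg, mul_zero, add_zero]
  · have hle := mul_le_mul_of_nonpos_left (Real.smoothTransition.le_one (1 + t / δ)) ht.le
    unfold smoothShift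
    linarith

/-- A regularization of the Hopf–Lax formula `min_{y ∈ s} (f y + ‖x - y‖² / t)`, at
`z = (t, x)`. -/
def hopfLax (ε δ : ℝ) (s : Finset F) (f : F → ℝ) (z : ℝ × F) : ℝ :=
  softMin ε s fun y ↦ f y + ‖z.2 - y‖ ^ 2 / smoothShift δ z.1

variable {s : Finset F} {f : F → ℝ}

theorem hopfLax_zero_le (hε : 0 < ε) (hδ : 0 < δ) {x y : F} (hy : y ∈ s) :
    hopfLax ε δ s f (0, x) ≤ f y + ‖x - y‖ ^ 2 / δ := by
  refine (softMin_le hε hy).trans_eq ?_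
  simp only [smoothShift_of_nonneg hδ le_rfl, add_zero]

theorem le_hopfLax_one (hε : 0 < ε) (hδ : 0 < δ) (hs : s.Nonempty) {k R : ℝ} {x : F}
    (hk : ∀ y ∈ s, k ≤ f y + ‖x - y‖ ^ 2) (hR : ∀ y ∈ s, ‖x - y‖ ^ 2 ≤ R) :
    k - δ * R - ε * Real.log s.card ≤ hopfLax ε δ s f (1, x) := by
  refine le_softMin hε hs fun y hy ↦ ?_
  have hcost : ‖x - y‖ ^ 2 - δ * R ≤ ‖x - y‖ ^ 2 / (δ + 1) := by
    rw [le_div_iff₀ (by positivity)]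
    nlinarith [mul_le_mul_of_nonneg_left (hR y hy) hδ.le, sq_nonneg ‖x - y‖, sq_nonneg δ]
  rw [smoothShift_of_nonneg hδ zero_le_one]
  linarith [hk y hy]

theorem exists_pos_norm_sub_sq_le {Ω : Set F} (hΩ : Bornology.IsBounded Ω) :
    ∃ R : ℝ, 0 < R ∧ ∀ x ∈ Ω, ∀ y ∈ Ω, ‖x - y‖ ^ 2 ≤ R := by
  refine ⟨Metric.diam Ω ^ 2 + 1, by positivity, fun x hx y hy ↦ ?_⟩
  rw [← dist_eq_norm]
  exact (pow_le_pow_left₀ dist_nonneg (Metric.dist_le_diam_of_mem hΩ hx hy) 2).trans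
    (le_add_of_nonneg_right zero_le_one)

theorem exists_finset_approx {Ω : Set F} (hΩ : IsCompact Ω) {φ : F → ℝ} (hφ : ContinuousOn φ Ω)
    {e r : ℝ} (he : 0 < e) (hr : 0 < r) :
    ∃ s : Finset F, ↑s ⊆ Ω ∧ ∀ x ∈ Ω, ∃ y ∈ s, φ y ≤ φ x + e ∧ ‖x - y‖ ^ 2 ≤ r := by
  obtain ⟨r₁, hr₁, hφr⟩ := Metric.uniformContinuousOn_iff.1
    (hΩ.uniformContinuousOn_of_continuous hφ) e he
  obtain ⟨s, hsΩ, hsfin, hscov⟩ := hΩ.finite_cover_balls (lt_min hr₁ (Real.sqrt_pos.2 hr))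
  lift s to Finset F using hsfin
  refine ⟨s, hsΩ, fun x hx ↦ ?_⟩
  obtain ⟨y, hy, hxy⟩ := mem_iUnion₂.1 (hscov hx)
  have hclose := hφr x hx y (hsΩ hy) (lt_of_lt_of_le hxy (min_le_left _ _))
  refine ⟨y, hy, by linarith [(abs_lt.1 (Real.dist_eq _ _ ▸ hclose)).1], ?_⟩
  rw [← dist_eq_norm]
  exact ((Real.lt_sqrt dist_nonneg).1 (lt_of_lt_of_le hxy (min_le_right _ _))).le

theorem exists_pos_mul_log_le (n : ℕ) {e : ℝ} (he : 0 < e) :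
    ∃ ε : ℝ, 0 < ε ∧ ε * Real.log n ≤ e := by
  have := Real.log_natCast_nonneg n
  refine ⟨e / (1 + Real.log n), by positivity, ?_⟩
  rw [div_mul_eq_mul_div, div_le_iff₀ (by positivity)]
  gcongr
  linarith

variable [InnerProductSpace ℝ F]

theorem contDiff_hopfLax (hδ : 0 < δ) (hs : s.Nonempty) : ContDiff ℝ 1 (hopfLax ε δ s f) := by
  refine contDiff_const.mul (ContDiff.log (ContDiff.sum fun y _ ↦ ?_) fun z ↦ (sum_exp_pos hs).ne')
  refine ContDiff.exp (ContDiff.div_const (ContDiff.neg (contDiff_const.add ?_)) _)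
  exact ((contDiff_snd.sub contDiff_const).norm_sq ℝ).div (contDiff_smoothShift.comp contDiff_fst)
    fun z ↦ (smoothShift_pos hδ _).ne'

theorem fderiv_hopfLax_le (hε : 0 < ε) (hδ : 0 < δ) (hs : s.Nonempty) {t : ℝ} (ht : 0 ≤ t)
    (x p : F) : fderiv ℝ (hopfLax ε δ s f) (t, x) (1, p) ≤ ‖p‖ ^ 2 := by
  have hdiff := (contDiff_hopfLax (ε := ε) (f := f) hδ hs).differentiable one_ne_zero (t, x)
  refine le_of_tendsto (hdiff.hasFDerivAt.hasLineDerivAt (1, p)).tendsto_slope_zero_right ?_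
  filter_upwards [self_mem_nhdsWithin] with h hh
  have hh : 0 < h := hh
  rw [smul_eq_mul, inv_mul_le_iff₀ hh, sub_le_iff_le_add']
  refine softMin_le_add hε hs fun y _ ↦ ?_
  have hcost := norm_add_smul_sq_div_le (x - y) p (add_pos_of_pos_of_nonneg hδ ht) hh.le
  simp only [Prod.smul_mk, Prod.mk_add_mk, smul_eq_mul, mul_one, smoothShift_of_nonneg hδ ht,
    smoothShift_of_nonneg hδ (add_nonneg ht hh.le), add_sub_right_comm x, ← add_assoc δ]
  linarith

theorem exists_subsolution {Ω : Set F} (hΩ : IsCompact Ω) (hne : Ω.Nonempty) {φ ψ : F → ℝ}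
    (hφ : ContinuousOn φ Ω) (h : ∀ x ∈ Ω, ∀ y ∈ Ω, φ x + ψ y ≤ ‖x - y‖ ^ 2) {e : ℝ} (he : 0 < e) :
    ∃ u : ℝ × F → ℝ, ContDiff ℝ 1 u ∧
      (∀ t, 0 ≤ t → ∀ x p, fderiv ℝ u (t, x) (1, p) ≤ ‖p‖ ^ 2) ∧
      (∀ x ∈ Ω, u (0, x) ≤ -φ x + e) ∧ ∀ y ∈ Ω, ψ y - e ≤ u (1, y) := by
  obtain ⟨R, hR, hRΩ⟩ := exists_pos_norm_sub_sq_le hΩ.isBounded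
  have he₂ : 0 < e / 2 := half_pos he
  obtain ⟨δ, hδ, hδR⟩ : ∃ δ : ℝ, 0 < δ ∧ δ * R = e / 2 :=
    ⟨e / 2 / R, by positivity, div_mul_cancel₀ _ hR.ne'⟩
  obtain ⟨s, hsΩ, hs⟩ := exists_finset_approx (φ := fun x ↦ -φ x) hΩ hφ.neg he₂ (mul_pos he₂ hδ)
  have hsne : s.Nonempty := (hs _ hne.some_mem).imp fun _ ↦ And.left
  obtain ⟨ε, hε, hεs⟩ := exists_pos_mul_log_le s.card he₂
  refine ⟨hopfLax ε δ s fun x ↦ -φ x, contDiff_hopfLax hδ hsne,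
    fun t ht ↦ fderiv_hopfLax_le hε hδ hsne ht, fun x hx ↦ ?_, fun y hy ↦ ?_⟩
  · obtain ⟨y, hy, hclose, hcost⟩ := hs x hx
    have hinitial := hopfLax_zero_le (f := fun x ↦ -φ x) (x := x) hε hδ hy
    have hcost_div := (div_le_iff₀ hδ).2 hcost
    linarith
  · have hfinal := le_hopfLax_one (f := fun x ↦ -φ x) (x := y) (k := ψ y) hε hδ hsne
      (fun z hz ↦ by
        have := norm_sub_rev z y ▸ h z (hsΩ hz) y hy
        linarith)
      fun z hz ↦ hRΩ y hy z (hsΩ hz)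
    linarith

end HopfLax

section BenamouBrenier

open ProbabilityTheory

theorem nonempty_of_compl_null {X : Type*} [MeasurableSpace X] {μ : Measure X}
    [IsProbabilityMeasure μ] {Ω : Set X} (hμ : μ Ωᶜ = 0) : Ω.Nonempty := by
  by_contra hempty
  rw [not_nonempty_iff_eq_empty.1 hempty, compl_empty, measure_univ] at hμ
  exact one_ne_zero hμ

theorem integral_le_of_compl_null {X : Type*} [MeasurableSpace X] {μ : Measure X}
    [IsProbabilityMeasure μ] {Ω : Set X} (hμ : μ Ωᶜ = 0) {g : X → ℝ} {c : ℝ}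
    (hg : Integrable g μ) (h : ∀ x ∈ Ω, g x ≤ c) : ∫ x, g x ∂μ ≤ c := by
  have hae : ∀ᵐ x ∂μ, g x ≤ c := by
    filter_upwards [show ∀ᵐ x ∂μ, x ∈ Ω from hμ] using h
  simpa only [integral_const, probReal_univ, one_smul] using
    integral_mono_ae hg (integrable_const c) hae

theorem integrable_fderiv_apply {X : Type*} [NormedAddCommGroup X] [NormedSpace ℝ X]
    [SecondCountableTopology X] [MeasurableSpace X] [OpensMeasurableSpace X] {P : Measure X}
    {s : Set X} (hs : IsCompact s) (hP : P sᶜ = 0) {φ : X → ℝ} (hφ : ContDiff ℝ 1 φ) {a : X → X}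
    (ha : Integrable a P) : Integrable (fun z ↦ fderiv ℝ φ z (a z)) P := by
  have hcont : Continuous (fderiv ℝ φ) := hφ.continuous_fderiv one_ne_zero
  obtain ⟨b, hb⟩ := hs.exists_bound_of_continuousOn hcont.continuousOn
  refine Integrable.mono' (ha.norm.const_mul b)
    (isBoundedBilinearMap_apply.continuous.comp_aestronglyMeasurable
      (hcont.aestronglyMeasurable.prodMk ha.aestronglyMeasurable)) ?_
  filter_upwards [show ∀ᵐ z ∂P, z ∈ s from hP] with z hz
  exact (fderiv ℝ φ z).le_of_opNorm_le (hb z hz) _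

theorem compProd_compl_prod_null {X Y : Type*} [MeasurableSpace X] [MeasurableSpace Y]
    {μ : Measure X} [SFinite μ] {κ : Kernel X Y} [IsSFiniteKernel κ] {s : Set X} {t : Set Y}
    (hs : MeasurableSet s) (ht : MeasurableSet t) (h : ∀ x ∈ s, κ x tᶜ = 0) :
    (μ.restrict s ⊗ₘ κ) (s ×ˢ t)ᶜ = 0 := by
  refine (Measure.ae_compProd_iff (p := (· ∈ s ×ˢ t)) (hs.prod ht)).2 ?_
  refine ae_restrict_of_forall_mem hs fun x hx ↦ ?_
  filter_upwards [show ∀ᵐ y ∂κ x, y ∈ t from h x hx] with y hy using ⟨hx, hy⟩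

variable {d : ℕ}

/-- The curves of measures that compete in the geodesic restriction of `W`, without prescribed
end points and with values in all of `𝒫(Ω)`. -/
structure IsLipschitzProbabilityCurve (Ω : Set (Euc d)) (ρ : ℝ → Measure (Euc d)) : Prop where
  isProbabilityMeasure : ∀ t ∈ Icc (0 : ℝ) 1, IsProbabilityMeasure (ρ t)
  concentrated : ∀ t ∈ Icc (0 : ℝ) 1, ρ t Ωᶜ = 0
  lipschitz : ∃ K : ℝ≥0, ∀ s ∈ Icc (0 : ℝ) 1, ∀ t ∈ Icc (0 : ℝ) 1,
    W (ρ s) (ρ t) ≤ K * edist s t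

namespace IsLipschitzProbabilityCurve

variable {Ω : Set (Euc d)} {ρ : ℝ → Measure (Euc d)} {v : ℝ → Euc d → Euc d}

theorem exists_isMarkovKernel (hρ : IsLipschitzProbabilityCurve Ω ρ) :
    ∃ κ : Kernel ℝ (Euc d), IsMarkovKernel κ ∧ EqOn κ ρ (Icc 0 1) := by
  obtain ⟨K, hK⟩ := hρ.lipschitz
  let ρ' : ℝ → Measure (Euc d) := fun t ↦ ρ (projIcc 0 1 zero_le_one t)
  have hprob : ∀ t, IsProbabilityMeasure (ρ' t) :=
    fun t ↦ hρ.isProbabilityMeasure _ (projIcc 0 1 zero_le_one t).2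
  have hmeas : Measurable ρ' := measurable_of_W_le (K := K) fun s t ↦ by
    refine (hK _ (projIcc 0 1 zero_le_one s).2 _ (projIcc 0 1 zero_le_one t).2).trans ?_
    gcongr
    simpa only [ENNReal.coe_one, one_mul, Subtype.edist_eq] using
      LipschitzWith.projIcc (zero_le_one (α := ℝ)) s t
  exact ⟨⟨ρ', hmeas⟩, ⟨hprob⟩, fun t ht ↦ congrArg (fun s : Icc (0 : ℝ) 1 ↦ ρ s)
    (projIcc_of_mem zero_le_one ht)⟩

/-- The continuity equation tested with a subsolution of the Hamilton–Jacobi equation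
`∂ₜφ + ‖∇φ‖² / 4 = 0`. -/
theorem ofReal_integral_sub_integral_le (hρ : IsLipschitzProbabilityCurve Ω ρ) (hΩ : IsCompact Ω)
    (hv : IsContinuityEq ρ v) (hfin : ∫⁻ t in Icc (0 : ℝ) 1, ∫⁻ x, ‖v t x‖ₑ ^ 2 ∂(ρ t) ≠ ⊤)
    {φ : ℝ × Euc d → ℝ} (hφ : ContDiff ℝ 1 φ)
    (hsub : ∀ t, 0 ≤ t → ∀ x p, fderiv ℝ φ (t, x) (1, p) ≤ ‖p‖ ^ 2) :
    ENNReal.ofReal ((∫ x, φ (1, x) ∂(ρ 1)) - ∫ x, φ (0, x) ∂(ρ 0)) ≤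
      ∫⁻ t in Icc (0 : ℝ) 1, ∫⁻ x, ‖v t x‖ₑ ^ 2 ∂(ρ t) := by
  obtain ⟨κ, hκ, hκρ⟩ := hρ.exists_isMarkovKernel
  let P : Measure (ℝ × Euc d) := volume.restrict (Icc (0 : ℝ) 1) ⊗ₘ κ
  have hP : P (Icc (0 : ℝ) 1 ×ˢ Ω)ᶜ = 0 := compProd_compl_prod_null measurableSet_Icc
    hΩ.measurableSet fun t ht ↦ hκρ ht ▸ hρ.concentrated t ht
  have hvm : Measurable fun z : ℝ × Euc d ↦ v z.1 z.2 := hv.measurable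
  have henergy : ∫⁻ z, ‖v z.1 z.2‖ₑ ^ 2 ∂P =
      ∫⁻ t in Icc (0 : ℝ) 1, ∫⁻ x, ‖v t x‖ₑ ^ 2 ∂(ρ t) := by
    rw [Measure.lintegral_compProd (by fun_prop)]
    exact setLIntegral_congr_fun measurableSet_Icc fun t ht ↦ by simp only [hκρ ht]
  have hswap : ∀ {g : ℝ × Euc d → ℝ}, Integrable g P →
      ∫ t in (0 : ℝ)..1, ∫ x, g (t, x) ∂(ρ t) = ∫ z, g z ∂P := fun {g} hg ↦ by
    rw [Measure.integral_compProd hg, intervalIntegral.integral_of_le zero_le_one,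
      ← integral_Icc_eq_integral_Ioc]
    exact setIntegral_congr_fun measurableSet_Icc fun t ht ↦ by simp only [hκρ ht]
  have hvL2 : MemLp (fun z : ℝ × Euc d ↦ v z.1 z.2) 2 P := by
    refine ⟨hvm.aestronglyMeasurable, ?_⟩
    rw [eLpNorm_lt_top_iff_lintegral_rpow_enorm_lt_top two_ne_zero ENNReal.ofNat_ne_top]
    simpa only [ENNReal.toReal_ofNat, ENNReal.rpow_ofNat, henergy] using hfin.lt_top
  have hint : ∀ {a : ℝ × Euc d → ℝ × Euc d}, Integrable a P →
      Integrable (fun z ↦ fderiv ℝ φ z (a z)) P :=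
    integrable_fderiv_apply (isCompact_Icc.prod hΩ) hP hφ
  have htime := hint (a := fun _ ↦ (1, 0)) (integrable_const _)
  have hspace := hint (a := fun z ↦ (0, v z.1 z.2))
    ((integrable_zero _ _ _).prodMk (hvL2.integrable one_le_two))
  rw [← hv.continuity φ hφ, hswap htime, hswap hspace, ← integral_add htime hspace, ← henergy]
  refine (ofReal_integral_le_lintegral_ofReal (htime.add hspace)).trans (lintegral_mono_ae ?_)
  filter_upwards [show ∀ᵐ z ∂P, z ∈ Icc (0 : ℝ) 1 ×ˢ Ω from hP] with z hz
  rw [Pi.add_apply, ← map_add, Prod.mk_add_mk, add_zero, zero_add, ← ofReal_norm,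
    ← ENNReal.ofReal_pow (norm_nonneg _)]
  exact ENNReal.ofReal_le_ofReal (hsub z.1 hz.1.1 z.2 _)

theorem W_sq_le_lintegral (hρ : IsLipschitzProbabilityCurve Ω ρ) (hΩ : IsCompact Ω)
    (hv : IsContinuityEq ρ v) :
    W (ρ 0) (ρ 1) ^ 2 ≤ ∫⁻ t in Icc (0 : ℝ) 1, ∫⁻ x, ‖v t x‖ₑ ^ 2 ∂(ρ t) := by
  rcases eq_or_ne (∫⁻ t in Icc (0 : ℝ) 1, ∫⁻ x, ‖v t x‖ₑ ^ 2 ∂(ρ t)) ⊤ with htop | hfin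
  · exact htop ▸ le_top
  have h0 : (0 : ℝ) ∈ Icc (0 : ℝ) 1 := unitInterval.zero_mem
  have h1 : (1 : ℝ) ∈ Icc (0 : ℝ) 1 := unitInterval.one_mem
  have := hρ.isProbabilityMeasure 0 h0
  have := hρ.isProbabilityMeasure 1 h1
  have hne : Ω.Nonempty := nonempty_of_compl_null (hρ.concentrated 0 h0)
  rw [← ENNReal.ofReal_toReal hfin]
  refine W_sq_le_of_dual hΩ (hρ.concentrated 0 h0) (hρ.concentrated 1 h1) fun φ ψ hφψ ↦
    le_of_forall_pos_le_add fun e he ↦ ?_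
  obtain ⟨u, hu, hsub, hu0, hu1⟩ := exists_subsolution hΩ hne φ.continuous.continuousOn hφψ
    (half_pos he)
  have htest := ENNReal.ofReal_le_iff_le_toReal hfin |>.1
    (hρ.ofReal_integral_sub_integral_le hΩ hv hfin hu hsub)
  have hint : ∀ t ∈ Icc (0 : ℝ) 1, ∀ {g : Euc d → ℝ}, Continuous g → Integrable g (ρ t) :=
    fun t ht g hg ↦ by
      have := hρ.isProbabilityMeasure t ht
      exact integrable_of_isCompact hΩ (hρ.concentrated t ht) hg.continuousOn
  have hut : ∀ t : ℝ, Continuous fun x ↦ u (t, x) :=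
    fun t ↦ hu.continuous.comp (Continuous.prodMk_right t)
  have hinitial : ∫ x, φ x + u (0, x) ∂(ρ 0) ≤ e / 2 :=
    integral_le_of_compl_null (hρ.concentrated 0 h0) (hint 0 h0 (φ.continuous.add (hut 0)))
      fun x hx ↦ by linarith [hu0 x hx]
  have hfinal : ∫ y, ψ y - u (1, y) ∂(ρ 1) ≤ e / 2 :=
    integral_le_of_compl_null (hρ.concentrated 1 h1) (hint 1 h1 (ψ.continuous.sub (hut 1)))
      fun y hy ↦ by linarith [hu1 y hy]
  rw [integral_add (hint 0 h0 φ.continuous) (hint 0 h0 (hut 0))] at hinitial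
  rw [integral_sub (hint 1 h1 ψ.continuous) (hint 1 h1 (hut 1))] at hfinal
  linarith

end IsLipschitzProbabilityCurve

theorem W_le_WRestr {Ω : Set (Euc d)} {Λ : Set (Measure (Euc d))} (hΩ : IsCompact Ω)
    (hprob : ∀ μ ∈ Λ, IsProbabilityMeasure μ) (hconc : ∀ μ ∈ Λ, μ Ωᶜ = 0)
    (μ ν : Measure (Euc d)) : W μ ν ≤ WRestr Λ μ ν := by
  refine le_iInf₂ fun ρ hρ ↦ ?_
  have hcurve : IsLipschitzProbabilityCurve Ω ρ :=
    ⟨fun t ht ↦ hprob _ (hρ.mem t ht), fun t ht ↦ hconc _ (hρ.mem t ht), hρ.lipschitz⟩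
  rw [← ENNReal.pow_le_pow_left_iff two_ne_zero, rpow_half_sq]
  refine le_iInf₂ fun v hv ↦ ?_
  rw [← hρ.source, ← hρ.target]
  exact hcurve.W_sq_le_lintegral hΩ hv

end BenamouBrenier

section GradientTransport

section Potential

variable {F : Type*} [NormedAddCommGroup F] {Ω : Set F} {f : F → ℝ} {g : F → F}

/-- The largest function `u` such that `u y - f x ≤ ‖x - y‖² / 2` for `x ∈ Ω`: the `c`-transform
of `-f` for the quadratic cost. -/
def cTransform (Ω : Set F) (f : F → ℝ) (y : F) : ℝ :=
  sInf ((fun x ↦ f x + ‖x - y‖ ^ 2 / 2) '' Ω)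

theorem continuous_cTransform (hΩ : IsCompact Ω) (hf : Continuous f) :
    Continuous (cTransform Ω f) :=
  hΩ.continuous_sInf (f := fun y x ↦ f x + ‖x - y‖ ^ 2 / 2) (by fun_prop)

theorem cTransform_le (hΩ : IsCompact Ω) (hf : Continuous f) {x : F} (hx : x ∈ Ω) (y : F) :
    cTransform Ω f y ≤ f x + ‖x - y‖ ^ 2 / 2 :=
  csInf_le (hΩ.bddBelow_image (by fun_prop)) (mem_image_of_mem _ hx)

theorem le_cTransform (hΩ : Ω.Nonempty) {y : F} {k : ℝ} (h : ∀ x ∈ Ω, k ≤ f x + ‖x - y‖ ^ 2 / 2) :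
    k ≤ cTransform Ω f y :=
  le_csInf (hΩ.image _) (forall_mem_image.2 h)

variable [InnerProductSpace ℝ F]

theorem add_inner_sub_le_of_gradient [CompleteSpace F] {K : ℝ≥0}
    (hf : ∀ x, HasGradientAt f (g x) x) (hg : LipschitzWith K g) (x z : F) :
    f x + inner ℝ (g x) (z - x) - K * ‖z - x‖ ^ 2 ≤ f z := by
  have hremainder := (convex_segment x z).norm_image_sub_le_of_norm_hasFDerivWithin_le'
    (𝕜 := ℝ) (φ := InnerProductSpace.toDual ℝ F (g x)) (C := K * ‖z - x‖)
    (fun y _ ↦ (hf y).hasFDerivAt.hasFDerivWithinAt) (fun y hy ↦ ?_)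
    (left_mem_segment ℝ x z) (right_mem_segment ℝ x z)
  · rw [InnerProductSpace.toDual_apply_apply, Real.norm_eq_abs] at hremainder
    linarith [(abs_le.1 hremainder).1]
  · rw [← map_sub, LinearIsometryEquiv.norm_map]
    obtain ⟨s, hs, rfl⟩ := (segment_eq_image' ℝ x z).subset hy
    refine (hg.norm_sub_le _ _).trans ?_
    gcongr
    rw [add_sub_cancel_left, norm_smul, Real.norm_of_nonneg hs.1]
    exact mul_le_of_le_one_left (norm_nonneg _) hs.2

theorem half_norm_sq_sub_le (a r u : F) {A R : ℝ} (ha : ‖a‖ ≤ A) (hr : ‖r‖ ≤ R) :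
    (‖a‖ ^ 2 - (2 * A * R + R ^ 2)) / 2 ≤
      inner ℝ a u - 1 / 4 * ‖u‖ ^ 2 + ‖u - (a + r)‖ ^ 2 / 2 := by
  have hsquare : 0 ≤ ‖(1 / 2 : ℝ) • u - r‖ ^ 2 := by positivity
  have hcross : ‖a‖ * ‖r‖ ≤ A * R := mul_le_mul ha hr (norm_nonneg _) ((norm_nonneg _).trans ha)
  have hinner := (abs_le.1 (abs_real_inner_le_norm a r)).1
  have hrR : ‖r‖ ^ 2 ≤ R ^ 2 := pow_le_pow_left₀ (norm_nonneg _) hr 2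
  rw [norm_sub_sq_real, norm_smul, real_inner_smul_left, Real.norm_of_nonneg (by norm_num)]
    at hsquare
  rw [norm_sub_sq_real, norm_add_sq_real, inner_add_right, real_inner_comm a u]
  linarith

theorem add_le_potential_add [CompleteSpace F] {K : ℝ≥0} (hf : ∀ x, HasGradientAt f (g x) x)
    (hg : LipschitzWith K g) (hK : (K : ℝ) ≤ 1 / 4) {x y : F} {A R : ℝ} (hA : ‖g x‖ ≤ A)
    (hR : ‖y - x - g x‖ ≤ R) (z : F) :
    f x + (‖g x‖ ^ 2 - (2 * A * R + R ^ 2)) / 2 ≤ f z + ‖z - y‖ ^ 2 / 2 := by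
  have hpotential := add_inner_sub_le_of_gradient hf hg x z
  have hconvexity : K * ‖z - x‖ ^ 2 ≤ 1 / 4 * ‖z - x‖ ^ 2 := by gcongr
  have hquadratic := half_norm_sq_sub_le (g x) (y - x - g x) (z - x) hA hR
  rw [show z - x - (g x + (y - x - g x)) = z - y by abel] at hquadratic
  linarith

end Potential

variable {d : ℕ} {Ω : Set (Euc d)} {μ : Measure (Euc d)} [IsProbabilityMeasure μ]

/-- The potential of a small gradient field and its `c`-transform are almost optimal in the
Kantorovich dual problem. -/
theorem ofReal_integral_norm_sq_sub_le_W_sq {f : Euc d → ℝ} {g Y : Euc d → Euc d} {K : ℝ≥0}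
    {A R : ℝ} (hf : ∀ x, HasGradientAt f (g x) x) (hg : LipschitzWith K g) (hK : (K : ℝ) ≤ 1 / 4)
    (hA : ∀ x, ‖g x‖ ≤ A) (hY : Continuous Y) (hR : ∀ x, ‖Y x - x - g x‖ ≤ R)
    (hΩ : IsCompact Ω) (hμ : μ Ωᶜ = 0) (hYμ : (μ.map Y) Ωᶜ = 0) :
    ENNReal.ofReal (∫ x, ‖g x‖ ^ 2 ∂μ - (2 * A * R + R ^ 2)) ≤ W μ (μ.map Y) ^ 2 := by
  have hfc : Continuous f := continuous_iff_continuousAt.2 fun x ↦ (hf x).continuousAt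
  have hgc := hg.continuous
  have huc := continuous_cTransform hΩ hfc
  have := Measure.isProbabilityMeasure_map (μ := μ) hY.aemeasurable
  have hint : ∀ {h : Euc d → ℝ}, Continuous h → Integrable h μ :=
    fun hh ↦ integrable_of_isCompact hΩ hμ hh.continuousOn
  have hint_sq : Integrable (fun x ↦ ‖g x‖ ^ 2) μ := hint (by fun_prop)
  refine le_trans (ENNReal.ofReal_le_ofReal ?_) (ofReal_integral_add_integral_le_W_sq hμ hYμ
    (φ := fun x ↦ -(2 * f x)) (ψ := fun y ↦ 2 * cTransform Ω f y)
    (hint (by fun_prop)) (integrable_of_isCompact hΩ hYμ (by fun_prop))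
    fun x hx y _ ↦ by linarith [cTransform_le hΩ hfc hx y])
  rw [integral_map hY.aemeasurable (by fun_prop), ← integral_add (hint (by fun_prop))
    (hint (by fun_prop))]
  calc ∫ x, ‖g x‖ ^ 2 ∂μ - (2 * A * R + R ^ 2)
      = ∫ x, (‖g x‖ ^ 2 - (2 * A * R + R ^ 2)) ∂μ := by
        rw [integral_sub hint_sq (integrable_const _), integral_const,
          probReal_univ, one_smul]
    _ ≤ ∫ x, (-(2 * f x) + 2 * cTransform Ω f (Y x)) ∂μ := by
        refine integral_mono (hint (by fun_prop)) (hint (by fun_prop)) fun x ↦ ?_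
        have := le_cTransform (nonempty_of_compl_null hμ) fun z _ ↦
          add_le_potential_add hf hg hK (hA x) (hR x) z
        linarith

theorem IsGlobalFlow.lintegral_field_sq_le_W_sq_add {w Φ : ℝ → Euc d → Euc d} {A K : ℝ≥0}
    (hΦ : IsGlobalFlow w Φ) (hw : IsLipschitzField w A K) {f : Euc d → ℝ}
    (hf : ∀ x, HasGradientAt f (w 0 x) x) (hA : (A : ℝ) ≤ 1 / 4) (hΩ : IsCompact Ω)
    (hμ : μ Ωᶜ = 0) (hΦμ : (μ.map (Φ 1)) Ωᶜ = 0) {t : ℝ} (ht : t ∈ Icc (0 : ℝ) 1) :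
    ∫⁻ x, ‖w t (Φ t x)‖ₑ ^ 2 ∂μ ≤ W μ (μ.map (Φ 1)) ^ 2 +
      ENNReal.ofReal (2 * (2 * A * (A ^ 2 + K) + (A ^ 2 + K) ^ 2)) := by
  set R : ℝ := A ^ 2 + K
  have hR : 0 ≤ R := by positivity
  set q : ℝ := 2 * A * R + R ^ 2
  have : 0 ≤ q := by positivity
  have hpointwise : ∀ x, ‖w t (Φ t x)‖ ^ 2 ≤ ‖w 0 x‖ ^ 2 + q := fun x ↦ by
    have hnear : ‖w t (Φ t x)‖ ≤ ‖w 0 x‖ + R :=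
      (norm_le_norm_add_norm_sub' _ (w 0 x)).trans
        (add_le_add_right (hΦ.norm_field_sub_le hw x ht) _)
    have hsq := pow_le_pow_left₀ (norm_nonneg _) hnear 2
    have hcross := mul_le_mul_of_nonneg_right (hw.norm_le 0 x) hR
    linarith
  have hint : Integrable (fun x ↦ ‖w 0 x‖ ^ 2) μ := integrable_of_isCompact hΩ hμ
    ((hw.lipschitzWith_space 0).continuous.norm.pow 2).continuousOn
  have hint_add : Integrable (fun x ↦ ‖w 0 x‖ ^ 2 + q) μ := hint.add (integrable_const q)
  calc ∫⁻ x, ‖w t (Φ t x)‖ₑ ^ 2 ∂μ ≤ ∫⁻ x, ENNReal.ofReal (‖w 0 x‖ ^ 2 + q) ∂μ := by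
        refine lintegral_mono fun x ↦ ?_
        rw [← ofReal_norm, ← ENNReal.ofReal_pow (norm_nonneg _)]
        exact ENNReal.ofReal_le_ofReal (hpointwise x)
    _ = ENNReal.ofReal (∫ x, ‖w 0 x‖ ^ 2 ∂μ - q + 2 * q) := by
        rw [← ofReal_integral_eq_lintegral_ofReal hint_add
          (ae_of_all _ fun x ↦ by positivity), integral_add hint (integrable_const q),
          integral_const, probReal_univ, one_smul]
        ring_nf
    _ ≤ _ := ENNReal.ofReal_add_le.trans (add_le_add_left
        (ofReal_integral_norm_sq_sub_le_W_sq hf (hw.lipschitzWith_space 0) hA (hw.norm_le 0)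
          (hΦ.continuous_apply 1) (hΦ.norm_sub_id_sub_le hw) hΩ hμ hΦμ) _)

end GradientTransport

section TransportedFamily

theorem WRestr_sq_le_of_isContinuityEq {d : ℕ} {Λ : Set (Measure (Euc d))} {μ ν : Measure (Euc d)}
    {ρ : ℝ → Measure (Euc d)} {v : ℝ → Euc d → Euc d} {Z : ℝ≥0∞} (hρ : IsLipCurve Λ μ ν ρ)
    (hv : IsContinuityEq ρ v) (hZ : ∀ t ∈ Icc (0 : ℝ) 1, ∫⁻ x, ‖v t x‖ₑ ^ 2 ∂ρ t ≤ Z) :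
    WRestr Λ μ ν ^ 2 ≤ Z := by
  calc WRestr Λ μ ν ^ 2 ≤ (energy ρ ^ (1 / 2 : ℝ)) ^ 2 := by gcongr; exact iInf₂_le ρ hρ
    _ = energy ρ := rpow_half_sq _
    _ ≤ ∫⁻ t in Icc (0 : ℝ) 1, ∫⁻ x, ‖v t x‖ₑ ^ 2 ∂ρ t := iInf₂_le v hv
    _ ≤ ∫⁻ _ in Icc (0 : ℝ) 1, Z := setLIntegral_mono measurable_const hZ
    _ = Z := by simp

theorem isLipschitzField_comp_projIcc {F : Type*} [NormedAddCommGroup F] {v : ℝ → F → F}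
    {A K : ℝ≥0} (hbound : ∀ t ∈ Ico (0 : ℝ) 1, ∀ x, ‖v t x‖ ≤ A)
    (hspace : ∀ t ∈ Ico (0 : ℝ) 1, LipschitzWith A (v t))
    (htime : ∀ x, LipschitzOnWith K (fun t ↦ v t x) (Icc 0 1)) :
    IsLipschitzField (fun t ↦ v (projIcc 0 1 zero_le_one t)) A K := by
  have hclosure : closure (Ico (0 : ℝ) 1) = Icc 0 1 := closure_Ico zero_ne_one
  have hcont : ∀ x, ContinuousOn (fun t ↦ v t x) (closure (Ico 0 1)) :=
    fun x ↦ hclosure ▸ (htime x).continuousOn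
  have hmem : ∀ t : ℝ, (projIcc 0 1 zero_le_one t : ℝ) ∈ closure (Ico (0 : ℝ) 1) :=
    fun t ↦ hclosure.symm ▸ Subtype.prop _
  refine ⟨fun t x ↦ ?_, fun t ↦ LipschitzWith.of_dist_le_mul fun x y ↦ ?_, fun x ↦ ?_⟩
  · exact le_on_closure (fun s hs ↦ hbound s hs x) (hcont x).norm continuousOn_const (hmem t)
  · exact le_on_closure (fun s hs ↦ (hspace s hs).dist_le_mul x y)
      (continuous_dist.comp_continuousOn ((hcont x).prodMk (hcont y))) continuousOn_const (hmem t)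
  · exact mul_one K ▸
      (htime x).to_restrict.comp (LipschitzWith.projIcc (zero_le_one (α := ℝ)))

variable {d m : ℕ} {M : Type*} [EMetricSpace M] [ChartedSpace (Euc m) M]

/-- The velocity field induced by a curve on `[0, 1]`, frozen at its end values outside
`[0, 1]`. -/
def frozenVelField (B : ∀ θ : M, TangentSpace (𝓡 m) θ →ₗ[ℝ] (Euc d → Euc d)) (γ : ℝ → M) (t : ℝ) :
    Euc d → Euc d :=
  velField B γ (projIcc 0 1 zero_le_one t)

theorem frozenVelField_eqOn (B : ∀ θ : M, TangentSpace (𝓡 m) θ →ₗ[ℝ] (Euc d → Euc d))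
    (γ : ℝ → M) : EqOn (frozenVelField B γ) (velField B γ) (Icc 0 1) := fun t ht ↦ by
  rw [frozenVelField, projIcc_of_mem zero_le_one ht]

variable [RiemannianBundle (fun x : M ↦ TangentSpace (𝓡 m) x)]

/-- The measures `E θ`, `θ ∈ S`, are embedded with bi-Lipschitz constant `L`, and along the curves
`c θ η` of a minimizing family they are transported by the velocity fields `B`, which are gradients
and satisfy the `C¹` and time derivative bounds with constant `C`. The bounds are stated as
Lipschitz bounds, and for the initial velocities `η ∈ D θ` only. -/
structure IsTransportedFamily (Ω : Set (Euc d)) (S : Set M)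
    (D : ∀ θ : M, Set (TangentSpace (𝓡 m) θ)) (c : ∀ θ : M, TangentSpace (𝓡 m) θ → ℝ → M)
    (E : M → Measure (Euc d)) (B : ∀ θ : M, TangentSpace (𝓡 m) θ →ₗ[ℝ] (Euc d → Euc d))
    (L C : ℝ≥0) : Prop extends IsMinimizingFamily S D c where
  isCompact_domain : IsCompact Ω
  isProbabilityMeasure : ∀ θ ∈ S, IsProbabilityMeasure (E θ)
  concentrated : ∀ θ ∈ S, E θ Ωᶜ = 0
  W_le : ∀ θ₀ ∈ S, ∀ θ₁ ∈ S, W (E θ₀) (E θ₁) ≤ L * edist θ₀ θ₁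
  edist_le : ∀ θ₀ ∈ S, ∀ θ₁ ∈ S, edist θ₀ θ₁ ≤ L * W (E θ₀) (E θ₁)
  gradient : ∀ θ ∈ S, ∀ η ∈ D θ, ∃ f : Euc d → ℝ, ∀ x, HasGradientAt f (B θ η x) x
  norm_field_le : ∀ θ ∈ S, ∀ η ∈ D θ, ∀ x, ‖B θ η x‖ ≤ C * ‖η‖
  lipschitzWith_space : ∀ θ ∈ S, ∀ η ∈ D θ, LipschitzWith (C * ‖η‖₊) (B θ η)
  lipschitzOnWith_time : ∀ θ ∈ S, ∀ η ∈ D θ, ∀ x,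
    LipschitzOnWith (C * ‖η‖₊ ^ 2) (fun t ↦ velField B (c θ η) t x) (Icc 0 1)
  map_flow : ∀ θ ∈ S, ∀ η ∈ D θ, ∀ Φ, IsFlow Ω (velField B (c θ η)) Φ →
    ∀ t ∈ Icc (0 : ℝ) 1, E (c θ η t) = (E θ).map (Φ t)

theorem two_mul_excess_le {C a : ℝ} (hC : 0 ≤ C) (ha : 0 ≤ a) (h : C * a ≤ 1 / 4) :
    2 * (2 * (C * a) * ((C * a) ^ 2 + C * a ^ 2) + ((C * a) ^ 2 + C * a ^ 2) ^ 2) ≤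
      5 * C * (C + 1) ^ 2 * a ^ 3 := by
  have hquartic : C * a * (C * (C + 1) ^ 2 * a ^ 3) ≤ 1 / 4 * (C * (C + 1) ^ 2 * a ^ 3) := by
    gcongr
  have hcubic : 0 ≤ C * (C + 1) * a ^ 3 := by positivity
  have hcubic' : 0 ≤ C ^ 2 * (C + 1) * a ^ 3 := by positivity
  linarith

theorem sq_le_of_one_fourth_le {C a : ℝ} (hC : 0 ≤ C) (ha : 0 ≤ a) (h : 1 / 4 ≤ C * a) :
    (C * a) ^ 2 ≤ 5 * C * (C + 1) ^ 2 * a ^ 3 := by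
  have hcubic : (C * a) ^ 2 * (1 / 4) ≤ (C * a) ^ 2 * (C * a) := by gcongr
  have hpos : 0 ≤ (C ^ 3 + 10 * C ^ 2 + 5 * C) * a ^ 3 := by positivity
  linarith

namespace IsTransportedFamily

variable {Ω : Set (Euc d)} {S : Set M} {D : ∀ θ : M, Set (TangentSpace (𝓡 m) θ)}
  {c : ∀ θ : M, TangentSpace (𝓡 m) θ → ℝ → M} {E : M → Measure (Euc d)}
  {B : ∀ θ : M, TangentSpace (𝓡 m) θ →ₗ[ℝ] (Euc d → Euc d)} {L C : ℝ≥0}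
  {θ : M} {η : TangentSpace (𝓡 m) θ} {Φ : ℝ → Euc d → Euc d}

theorem frozenVelField_zero (h : IsTransportedFamily Ω S D c E B L C) (hθ : θ ∈ S) (hη : η ∈ D θ) :
    frozenVelField B (c θ η) 0 = B θ η :=
  (frozenVelField_eqOn B _ ⟨le_rfl, zero_le_one⟩).trans
    (congrArg (fun z : TangentBundle (𝓡 m) M ↦ B z.1 z.2) (h.initial θ hθ η hη))

theorem W_le_WRestr (h : IsTransportedFamily Ω S D c E B L C) (μ ν : Measure (Euc d)) :
    W μ ν ≤ WRestr (E '' S) μ ν :=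
  WassersteinSubmanifold.W_le_WRestr h.isCompact_domain
    (forall_mem_image.2 h.isProbabilityMeasure) (forall_mem_image.2 h.concentrated) μ ν

theorem map_globalFlow (h : IsTransportedFamily Ω S D c E B L C) (hθ : θ ∈ S) (hη : η ∈ D θ)
    {A K : ℝ≥0} (hw : IsLipschitzField (frozenVelField B (c θ η)) A K)
    (hΦ : IsGlobalFlow (frozenVelField B (c θ η)) Φ) {t : ℝ} (ht : t ∈ Icc (0 : ℝ) 1) :
    E (c θ η t) = (E θ).map (Φ t) :=
  h.map_flow θ hθ η hη Φ (hΦ.isFlow hw (frozenVelField_eqOn B _)) t ht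

variable [IsRiemannianManifold (𝓡 m) M]

theorem isLipCurve (h : IsTransportedFamily Ω S D c E B L C) (hθ : θ ∈ S) (hη : η ∈ D θ) :
    IsLipCurve (E '' S) (E θ) (E (c θ η 1)) fun t ↦ E (c θ η t) where
  mem t ht := mem_image_of_mem E (h.mem θ hθ η hη t ht)
  lipschitz := by
    refine ⟨L * ‖η‖₊, fun s hs t ht ↦ (h.W_le _ (h.mem θ hθ η hη s hs) _
      (h.mem θ hθ η hη t ht)).trans ?_⟩
    rw [ENNReal.coe_mul, mul_assoc, ← enorm_eq_nnnorm, ← ofReal_norm]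
    gcongr
    exact (h.isMinimizingCurve θ hθ η hη).edist_le_mul hs ht
  source := congrArg E (h.apply_zero hθ hη)
  target := rfl

variable [IsManifold (𝓡 m) 1 M]
  [IsContinuousRiemannianBundle (Euc m) (fun x : M ↦ TangentSpace (𝓡 m) x)]

/-- The bounds on `B` hold on `D` only, but `(1 - t) • γ'(t)` belongs to `D (γ t)`. -/
theorem isLipschitzField (h : IsTransportedFamily Ω S D c E B L C) (hθ : θ ∈ S) (hη : η ∈ D θ) :
    IsLipschitzField (frozenVelField B (c θ η)) (C * ‖η‖₊) (C * ‖η‖₊ ^ 2) := by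
  refine isLipschitzField_comp_projIcc (fun t ht x ↦ ?_)
    (fun t ht ↦ LipschitzWith.of_dist_le_mul fun x y ↦ ?_) (h.lipschitzOnWith_time θ hθ η hη)
  all_goals
    have hS := h.mem θ hθ η hη t (Ico_subset_Icc_self ht)
    have hD := h.smul_velocity_mem hθ hη ht
    have hpos : 0 < 1 - t := sub_pos.2 ht.2
    have hnorm : ‖(1 - t) • velocity (m := m) (c θ η) t‖ = (1 - t) * ‖η‖ := by
      rw [norm_smul, Real.norm_of_nonneg hpos.le,
        (h.isMinimizingCurve θ hθ η hη).norm_velocity t (Ico_subset_Icc_self ht)]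
    refine le_of_mul_le_mul_left ?_ hpos
  · have hbound := h.norm_field_le _ hS _ hD x
    rw [map_smul, Pi.smul_apply, norm_smul, Real.norm_of_nonneg hpos.le, hnorm] at hbound
    exact hbound.trans_eq (by push_cast; ring)
  · have hbound := (h.lipschitzWith_space _ hS _ hD).dist_le_mul x y
    rw [map_smul, Pi.smul_apply, Pi.smul_apply, dist_smul₀, Real.norm_of_nonneg hpos.le,
      NNReal.coe_mul, coe_nnnorm, hnorm] at hbound
    exact hbound.trans_eq (by push_cast; ring)

theorem WRestr_sq_le (h : IsTransportedFamily Ω S D c E B L C) (hθ : θ ∈ S) (hη : η ∈ D θ)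
    (hΦ : IsGlobalFlow (frozenVelField B (c θ η)) Φ) {Z : ℝ≥0∞}
    (hZ : ∀ t ∈ Icc (0 : ℝ) 1, ∫⁻ x, ‖frozenVelField B (c θ η) t (Φ t x)‖ₑ ^ 2 ∂(E θ) ≤ Z) :
    WRestr (E '' S) (E θ) (E (c θ η 1)) ^ 2 ≤ Z := by
  have := h.isProbabilityMeasure θ hθ
  have hw := h.isLipschitzField hθ hη
  have hmap : ∀ t ∈ Icc (0 : ℝ) 1, E (c θ η t) = (E θ).map (Φ t) :=
    fun t ht ↦ h.map_globalFlow hθ hη hw hΦ ht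
  refine WRestr_sq_le_of_isContinuityEq (h.isLipCurve hθ hη)
    (hΦ.isContinuityEq hw h.isCompact_domain (h.concentrated θ hθ) hmap) fun t ht ↦ ?_
  have hwt := (hw.lipschitzWith_space t).continuous.measurable
  rw [hmap t ht, lintegral_map (by fun_prop) (hΦ.continuous_apply t).measurable]
  exact hZ t ht

theorem WRestr_sq_le_W_sq_add (h : IsTransportedFamily Ω S D c E B L C) (hθ : θ ∈ S)
    (hη : η ∈ D θ) :
    WRestr (E '' S) (E θ) (E (c θ η 1)) ^ 2 ≤
      W (E θ) (E (c θ η 1)) ^ 2 + ENNReal.ofReal (5 * C * (C + 1) ^ 2 * ‖η‖ ^ 3) := by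
  have := h.isProbabilityMeasure θ hθ
  have hw := h.isLipschitzField hθ hη
  obtain ⟨Φ, hΦ⟩ := hw.exists_isGlobalFlow
  have h1 : (1 : ℝ) ∈ Icc (0 : ℝ) 1 := ⟨zero_le_one, le_rfl⟩
  have hmap := h.map_globalFlow hθ hη hw hΦ h1
  refine h.WRestr_sq_le hθ hη hΦ fun t ht ↦ ?_
  rcases le_total (C * ‖η‖) (1 / 4) with hshort | hlong
  · obtain ⟨f, hf⟩ := h.gradient θ hθ η hη
    rw [← h.frozenVelField_zero hθ hη] at hf
    have hestimate := hΦ.lintegral_field_sq_le_W_sq_add hw hf hshort h.isCompact_domain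
      (h.concentrated θ hθ) (hmap ▸ h.concentrated _ (h.mem θ hθ η hη 1 h1)) ht
    rw [← hmap] at hestimate
    exact hestimate.trans (add_le_add_right
      (ENNReal.ofReal_le_ofReal (two_mul_excess_le C.2 (norm_nonneg η) hshort)) _)
  · refine le_add_left ?_
    calc ∫⁻ x, ‖frozenVelField B (c θ η) t (Φ t x)‖ₑ ^ 2 ∂(E θ)
        ≤ ∫⁻ _, ENNReal.ofReal ((C * ‖η‖) ^ 2) ∂(E θ) := by
          refine lintegral_mono fun x ↦ ?_
          rw [← ofReal_norm, ← ENNReal.ofReal_pow (norm_nonneg _)]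
          gcongr
          exact hw.norm_le t _
      _ = ENNReal.ofReal ((C * ‖η‖) ^ 2) := by
          rw [lintegral_const, measure_univ, mul_one]
      _ ≤ _ := ENNReal.ofReal_le_ofReal (sq_le_of_one_fourth_le C.2 (norm_nonneg η) hlong)

end IsTransportedFamily

end TransportedFamily

theorem sub_le_mul_sq_of_sq_le {e w a k L : ℝ} (hw : 0 < w) (hwe : w ≤ e) (ha : 0 ≤ a) (hk : 0 ≤ k)
    (haw : a ≤ L * w) (h : e ^ 2 ≤ w ^ 2 + k * a ^ 3) : e - w ≤ k * L ^ 3 * w ^ 2 := by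
  have hcubic : k * a ^ 3 ≤ k * (L * w) ^ 3 := by gcongr
  have hfactor : (e - w) * w ≤ (e - w) * (e + w) := by
    gcongr; linarith
  refine le_of_mul_le_mul_right ?_ hw
  linarith

theorem toReal_sq_le_of_sq_le {e w : ℝ≥0∞} {r : ℝ} (hw : w ≠ ⊤) (hr : 0 ≤ r)
    (h : e ^ 2 ≤ w ^ 2 + ENNReal.ofReal r) : e.toReal ^ 2 ≤ w.toReal ^ 2 + r := by
  have hreal := ENNReal.toReal_mono (by finiteness) h
  rwa [ENNReal.toReal_add (by finiteness) ENNReal.ofReal_ne_top, ENNReal.toReal_pow,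
    ENNReal.toReal_pow, ENNReal.toReal_ofReal hr] at hreal

section General

variable {d m : ℕ} {M : Type*} [EMetricSpace M] [ChartedSpace (Euc m) M]
  [RiemannianBundle (fun x : M ↦ TangentSpace (𝓡 m) x)]

theorem IsTransportedFamily.W_pos_and_lt_top_and_norm_le {Ω : Set (Euc d)} {S : Set M}
    {D : ∀ θ : M, Set (TangentSpace (𝓡 m) θ)} {c : ∀ θ : M, TangentSpace (𝓡 m) θ → ℝ → M}
    {E : M → Measure (Euc d)} {B : ∀ θ : M, TangentSpace (𝓡 m) θ →ₗ[ℝ] (Euc d → Euc d)}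
    {L C : ℝ≥0} {θ : M} {η : TangentSpace (𝓡 m) θ} (h : IsTransportedFamily Ω S D c E B L C)
    (hθ : θ ∈ S) (hη : η ∈ D θ) (hne : E θ ≠ E (c θ η 1)) :
    0 < W (E θ) (E (c θ η 1)) ∧ W (E θ) (E (c θ η 1)) < ⊤ ∧
      ‖η‖ ≤ L * (W (E θ) (E (c θ η 1))).toReal := by
  have hS := h.mem θ hθ η hη 1 ⟨zero_le_one, le_rfl⟩
  have hendpoints := (h.isMinimizingCurve θ hθ η hη).edist_endpoints
  rw [h.apply_zero hθ hη] at hendpoints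
  have hdist : edist θ (c θ η 1) ≠ 0 := fun hzero ↦ hne (congrArg E (edist_eq_zero.1 hzero))
  have hlower := h.edist_le θ hθ _ hS
  have hupper := h.W_le θ hθ _ hS
  have htop : W (E θ) (E (c θ η 1)) < ⊤ := hupper.trans_lt (by rw [hendpoints]; finiteness)
  refine ⟨pos_iff_ne_zero.2 fun hzero ↦ hdist ?_, htop, ?_⟩
  · rwa [hzero, mul_zero, nonpos_iff_eq_zero] at hlower
  · have hreal := ENNReal.toReal_mono (by finiteness) hlower
    rwa [hendpoints, ENNReal.toReal_ofReal (norm_nonneg η), ENNReal.toReal_mul,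
      ENNReal.coe_toReal] at hreal

theorem mainTheorem4_general [IsManifold (𝓡 m) 1 M]
    [IsContinuousRiemannianBundle (Euc m) (fun x : M ↦ TangentSpace (𝓡 m) x)]
    [IsRiemannianManifold (𝓡 m) M] {Ω : Set (Euc d)} {S : Set M}
    {D : ∀ θ : M, Set (TangentSpace (𝓡 m) θ)} {c : ∀ θ : M, TangentSpace (𝓡 m) θ → ℝ → M}
    {E : M → Measure (Euc d)} {B : ∀ θ : M, TangentSpace (𝓡 m) θ →ₗ[ℝ] (Euc d → Euc d)}
    {L C : ℝ≥0} (h : IsTransportedFamily Ω S D c E B L C) :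
    ∃ K : ℝ, 0 < K ∧ ∀ μ ∈ E '' S, ∀ ν ∈ E '' S, μ ≠ ν →
      0 < W μ ν ∧ W μ ν < ⊤ ∧ WRestr (E '' S) μ ν < ⊤ ∧
      0 ≤ ((WRestr (E '' S) μ ν).toReal - (W μ ν).toReal) / (W μ ν).toReal ^ 2 ∧
      ((WRestr (E '' S) μ ν).toReal - (W μ ν).toReal) / (W μ ν).toReal ^ 2 ≤ K := by
  refine ⟨5 * C * (C + 1) ^ 2 * L ^ 3 + 1, by positivity, ?_⟩
  rintro _ ⟨θ₀, hθ₀, rfl⟩ _ ⟨θ₁, hθ₁, rfl⟩ hne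
  obtain ⟨η, hη, rfl⟩ := h.exists_joining θ₀ hθ₀ θ₁ hθ₁
  obtain ⟨hpos, htop, hlength⟩ := h.W_pos_and_lt_top_and_norm_le hθ₀ hη hne
  have hsq := h.WRestr_sq_le_W_sq_add hθ₀ hη
  have htop' : WRestr (E '' S) (E θ₀) (E (c θ₀ η 1)) < ⊤ :=
    (ENNReal.pow_lt_top_iff.1 (hsq.trans_lt (by finiteness))).resolve_right two_ne_zero
  have hle := ENNReal.toReal_mono htop'.ne (h.W_le_WRestr (E θ₀) (E (c θ₀ η 1)))
  have hpos' := ENNReal.toReal_pos hpos.ne' htop.ne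
  refine ⟨hpos, htop, htop', div_nonneg (sub_nonneg.2 hle) (sq_nonneg _), ?_⟩
  rw [div_le_iff₀ (by positivity)]
  have hestimate := sub_le_mul_sq_of_sq_le hpos' hle (norm_nonneg η) (by positivity) hlength
    (toReal_sq_le_of_sq_le htop.ne (by positivity) hsq)
  linarith [sq_nonneg (W (E θ₀) (E (c θ₀ η 1))).toReal]

end General

section Exponential

theorem isContinuousRiemannianBundle_of_isContMDiffRiemannianBundle {V : Type*}
    [NormedAddCommGroup V] [NormedSpace ℝ V] {H : Type*} [TopologicalSpace H]
    (I : ModelWithCorners ℝ V H) (n : ℕ∞ω) {X : Type*} [TopologicalSpace X] [ChartedSpace H X]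
    (F : Type*) [NormedAddCommGroup F] [NormedSpace ℝ F] (T : X → Type*)
    [TopologicalSpace (TotalSpace F T)] [∀ x, NormedAddCommGroup (T x)]
    [∀ x, InnerProductSpace ℝ (T x)] [FiberBundle F T] [VectorBundle ℝ F T]
    [h : IsContMDiffRiemannianBundle I n F T] : IsContinuousRiemannianBundle F T := by
  obtain ⟨g, hg, hinner⟩ := h.exists_contMDiff
  exact ⟨g, hg.continuous, hinner⟩

variable {d m : ℕ} {M : Type*} [EMetricSpace M] [ChartedSpace (Euc m) M]
  [RiemannianBundle (fun x : M ↦ TangentSpace (𝓡 m) x)]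

theorem expCurve_one (θ : M) (η : TangentSpace (𝓡 m) θ) : expCurve θ η 1 = riemExp θ η := by
  rw [expCurve, one_smul]

namespace MainAssumption

variable {Ω : Set (Euc d)} {S : Set M} {D : ∀ θ : M, Set (TangentSpace (𝓡 m) θ)}
  {E : M → Measure (Euc d)} {B : ∀ θ : M, TangentSpace (𝓡 m) θ →ₗ[ℝ] (Euc d → Euc d)}

theorem isMinimizingFamily (h : MainAssumption Ω S D E B) : IsMinimizingFamily S D expCurve where
  initial θ hθ η hη := (h.geodesic θ hθ η hη).initial
  isMinimizingCurve θ hθ η hη :=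
    { contMDiffOn := (h.geodesic θ hθ η hη).contMDiffOn.of_le one_le_two
      norm_velocity := h.speed θ hθ η hη
      edist_endpoints := by
        have hzero : expCurve θ η 0 = θ :=
          congrArg TotalSpace.proj (h.geodesic θ hθ η hη).initial
        rw [hzero, expCurve_one, h.minimizing θ hθ η hη, ofReal_norm] }
  mem := h.geodesic_mem
  exists_joining := by simpa only [expCurve_one] using h.exists_geodesic

variable [IsRiemannianManifold (𝓡 m) M]

theorem exists_isTransportedFamily (h : MainAssumption Ω S D E B) :
    ∃ L C : ℝ≥0, IsTransportedFamily Ω S D expCurve E B L C := by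
  obtain ⟨L, hL⟩ := h.biLipschitz
  obtain ⟨C, hC, hbounds⟩ := h.bounds
  lift C to ℝ≥0 using hC.le
  have hfamily := h.isMinimizingFamily
  refine ⟨L, C, hfamily, h.isCompact_domain, h.isProbabilityMeasure, h.concentrated,
    fun θ₀ hθ₀ θ₁ hθ₁ ↦ (hL θ₀ hθ₀ θ₁ hθ₁).1, fun θ₀ hθ₀ θ₁ hθ₁ ↦ (hL θ₀ hθ₀ θ₁ hθ₁).2,
    fun θ hθ η _ ↦ h.gradient θ hθ η, fun θ hθ η hη ↦ (hbounds θ hθ η hη).2.2.1,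
    fun θ hθ η hη ↦ ?_, fun θ hθ η hη x ↦ ?_, fun θ hθ η hη Φ hΦ t ht ↦ ?_⟩
  · exact lipschitzWith_of_nnnorm_fderiv_le ((h.contDiff θ hθ η).differentiable one_ne_zero)
      (hbounds θ hθ η hη).2.2.2.1
  · obtain ⟨-, -, -, -, hderiv⟩ := hbounds θ hθ η hη
    exact (convex_Icc 0 1).lipschitzOnWith_of_nnnorm_derivWithin_le
      (fun t ht ↦ (hderiv x t ht).1) (fun t ht ↦ (hderiv x t ht).2)
  · have hlipschitz : LipschitzOnWith ‖η‖₊ (expCurve θ η) (Icc 0 1) := fun s hs t ht ↦ by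
      rw [← enorm_eq_nnnorm, ← ofReal_norm]
      exact (hfamily.isMinimizingCurve θ hθ η hη).edist_le_mul hs ht
    rw [h.consistent _ (h.geodesic_mem θ hθ η hη) ⟨_, hlipschitz⟩ Φ hΦ t ht,
      hfamily.apply_zero hθ hη]

end MainAssumption

end Exponential

end WassersteinSubmanifold

end

open WassersteinSubmanifold in
theorem mainTheorem4 {d m : ℕ} {M : Type*} [EMetricSpace M] [ChartedSpace (Euc m) M]
    [IsManifold (𝓡 m) ∞ M] [RiemannianBundle (fun x : M ↦ TangentSpace (𝓡 m) x)]
    [IsContMDiffRiemannianBundle (𝓡 m) ∞ (Euc m) (fun x : M ↦ TangentSpace (𝓡 m) x)]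
    [IsRiemannianManifold (𝓡 m) M]
    (Ω : Set (Euc d)) (S : Set M) (D : ∀ θ : M, Set (TangentSpace (𝓡 m) θ))
    (E : M → Measure (Euc d)) (B : ∀ θ : M, TangentSpace (𝓡 m) θ →ₗ[ℝ] (Euc d → Euc d))
    (h : MainAssumption Ω S D E B) :
    ∃ C : ℝ, 0 < C ∧ ∀ μ ∈ E '' S, ∀ ν ∈ E '' S, μ ≠ ν →
      0 < W μ ν ∧ W μ ν < ⊤ ∧ WRestr (E '' S) μ ν < ⊤ ∧
      0 ≤ ((WRestr (E '' S) μ ν).toReal - (W μ ν).toReal) / (W μ ν).toReal ^ 2 ∧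
      ((WRestr (E '' S) μ ν).toReal - (W μ ν).toReal) / (W μ ν).toReal ^ 2 ≤ C := by
  have := isContinuousRiemannianBundle_of_isContMDiffRiemannianBundle (𝓡 m) ∞ (Euc m)
    fun x : M ↦ TangentSpace (𝓡 m) x
  obtain ⟨L, C, hfamily⟩ := h.exists_isTransportedFamily
  exact mainTheorem4_general hfamily
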